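/- Let $k\ge 1$ be an integer, let $\zeta$ be a complex primitive $k$-th root of unity and $\xi$ a complex primitive $(k+1)$-th root of unity. For integers $\ell$ put $u(\ell)=(1,\zeta^{\ell},\dots,\zeta^{(k-1)\ell})$ and $v(\ell)=(\xi^{\ell},\xi^{2\ell},\dots,\xi^{k\ell})$. For an integer $n$ let $N(n,k)$ be the nullity of the $2k\times 2k$ matrix whose rows are $(u(\ell)\mid v(\ell))$ for $\ell=0,\dots,k-1$ followed by $\ell=k+n,\dots,2k-1+n$. Let $G(n,k)$ be the directed graph on the vertices $0,1,\dots,k$ with the edges $$(i+n-2)\bmod (k+1)\ \to\ (i+n-1)\bmod k,\qquad 1\le i\le k,$$ where a loop counts as a cycle of length $1$. The line graph is obtained by joining consecutive points $(n,N(n,k))$, $0\le n\le k^2+k$, by line segments; a local peak is a point of it at which it has a local maximum (over the interval $[0,k^2+k]$). For $1\le q\le k$ and $1\le j\le q$ with $\gcd(j,q)=1$ write $f=\lfloor k/q\rfloor$, $m=k-fq$, $M=m+1$, let $(x)_q$ be the least nonnegative residue of $x$ modulo $q$, and put $$s(q,j)=|\{a\in[1,m]:(aj)_q\le (Mj)_q\}|,\qquad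 t(r,q,j)=|\{a\in[0,m]:(aj)_q<(rj)_q\}|,$$ $$\eta(q,j)=k\lfloor (k+1)j/q\rfloor-k+(Mj)_q f+s(q,j),$$ and, for $1\le w\le f$, $c(0)=c(q)=k-w$ and $c(r)=-1-w+(rj)_q f+t(r,q,j)$ for $1\le r\le q-1$. Then: 1. For $n>k$, $N(n,k)$ equals the nullity of the $n\times n$ skew-symmetric Toeplitz matrix whose first $k$ superdiagonals have all entries $1$ and whose remaining superdiagonals have all entries $0$. 2. For all such $q,j$, the graph $G(\eta(q,j),k)$ has exactly $f=\lfloor k/q\rfloor$ cycles; they all have length $q$, and they are the $f$ distinct cycles $$k-w=c(0)\to c(1)\to\dots\to c(q)=k-w,\qquad 1\le w\le f.$$ 3. The integers $\eta(q,j)$ with $1\le q\le k$, $1\le j\le q$, $\gcd(j,q)=1$ are all distinct, and the points $(\eta(q,j),\lfloor k/q\rfloor)$ are exactly the local peaks of the line graph. 4. These peaks determine all $N(n,k)$ with $0\le n<k^2+k$: for all such $q,j$ one has $f\le\eta(q,j)\le k^2+k-f$ and $N(n,k)=f-|n-\eta(q,j)|$ for all integers $n$ with $|n-\eta(q,j)|\le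 f$, and each integer $n\in[0,k^2+k)$ lies in $[\eta(q,j)-f,\eta(q,j)+f)$ for exactly one pair $(q,j)$. -/

import Mathlib

/-- The nullity (dimension of the kernel) of a square matrix over a field. -/
noncomputable def nullity {K ι : Type*} [Field K] [Fintype ι] (M : Matrix ι ι K) : ℕ :=
  Module.finrank K (LinearMap.ker M.mulVecLin)

/-- `A(n,k)`: the `n × n` skew-symmetric Toeplitz band matrix whose first `k` superdiagonals have
all entries `1` and whose remaining superdiagonals have all entries `0`. -/
def bandMatrix (n k : ℕ) : Matrix (Fin n) (Fin n) ℝ := fun a b =>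
  if (a : ℕ) < b ∧ (b : ℕ) ≤ a + k then 1
  else if (b : ℕ) < a ∧ (a : ℕ) ≤ b + k then -1
  else 0

/-- The row vector `u(ℓ) = (1, ζ ^ ℓ, ζ ^ (2 ℓ), …, ζ ^ ((k - 1) ℓ))`. -/
noncomputable def uRow (k : ℕ) (ζ : ℂ) (l : ℤ) : Fin k → ℂ := fun c => ζ ^ (((c : ℕ) : ℤ) * l)

/-- The row vector `v(ℓ) = (ξ ^ ℓ, ξ ^ (2 ℓ), …, ξ ^ (k ℓ))`. -/
noncomputable def vRow (k : ℕ) (ξ : ℂ) (l : ℤ) : Fin k → ℂ :=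
  fun c => ξ ^ ((((c : ℕ) : ℤ) + 1) * l)

/-- The `2k × 2k` matrix `V(n,k)`, whose rows are `(u(ℓ) | v(ℓ))` for `ℓ = 0, …, k - 1`, followed
by `ℓ = k + n, …, 2k - 1 + n`. -/
noncomputable def bigMatrix (k : ℕ) (ζ ξ : ℂ) (n : ℤ) :
    Matrix (Fin k ⊕ Fin k) (Fin k ⊕ Fin k) ℂ :=
  Matrix.fromBlocks
    (fun i => uRow k ζ ((i : ℕ) : ℤ)) (fun i => vRow k ξ ((i : ℕ) : ℤ))
    (fun i => uRow k ζ ((k : ℤ) + n + ((i : ℕ) : ℤ)))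
    (fun i => vRow k ξ ((k : ℤ) + n + ((i : ℕ) : ℤ)))

/-- `N(n,k)`, for every integer `n`: the nullity of `V(n,k)`. -/
noncomputable def bandNullity (k : ℕ) (ζ ξ : ℂ) (n : ℤ) : ℕ := nullity (bigMatrix k ζ ξ n)

/-- The directed graph `G(n,k)` on the vertices `0, 1, …, k`, with the edges
`(i + n - 2) mod (k + 1) → (i + n - 1) mod k` for `1 ≤ i ≤ k`. -/
def bandGraph (n : ℤ) (k : ℕ) : Digraph (Fin (k + 1)) where
  Adj a b := ∃ i : ℤ, 1 ≤ i ∧ i ≤ k ∧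
    ((a : ℕ) : ℤ) = (i + n - 2) % ((k : ℤ) + 1) ∧ ((b : ℕ) : ℤ) = (i + n - 1) % (k : ℤ)

/-- The (simple, directed) cycles of a digraph: nonempty cyclic sequences of distinct vertices
with an edge from each vertex to its cyclic successor.  A loop is a cycle of length `1`. -/
def Digraph.cycles {V : Type*} (G : Digraph V) : Set (Cycle V) :=
  {C | C ≠ Cycle.nil ∧ C.Nodup ∧ C.Chain G.Adj}

/-- `s(q,j)`, with `m = k mod q`. -/
def sCount (k q j : ℕ) : ℕ :=
  ((Finset.Icc 1 (k % q)).filter fun a => (a * j) % q ≤ ((k % q + 1) * j) % q).card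

/-- `t(r,q,j)`, with `m = k mod q`. -/
def tCount (k r q j : ℕ) : ℕ :=
  ((Finset.Icc 0 (k % q)).filter fun a => (a * j) % q < (r * j) % q).card

/-- `η(q,j)`, with `f = ⌊k/q⌋` and `m = k mod q`. -/
def eta (k q j : ℕ) : ℤ :=
  (k : ℤ) * (((k + 1) * j / q : ℕ) : ℤ) - (k : ℤ)
    + ((((k % q + 1) * j) % q : ℕ) : ℤ) * ((k / q : ℕ) : ℤ) + (sCount k q j : ℤ)

/-- The integers `c(r) = c(r,w,q,j)` for `0 ≤ r ≤ q - 1`, where `c(0) = k - w`. -/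
def cVertex (k q j w r : ℕ) : ℤ :=
  if r = 0 then (k : ℤ) - (w : ℤ)
  else -1 - (w : ℤ) + (((r * j) % q : ℕ) : ℤ) * ((k / q : ℕ) : ℤ) + (tCount k r q j : ℤ)

/-- The cyclic sequence `c(0) → c(1) → ⋯ → c(q - 1) → c(0)`. -/
def cCycle (k q j w : ℕ) : Cycle ℤ := (((List.range q).map (cVertex k q j w) : List ℤ) : Cycle ℤ)

/-- The admissible pairs `(q,j)`: `1 ≤ q ≤ k`, `1 ≤ j ≤ q`, `gcd(j,q) = 1`. -/
def admissible (k : ℕ) : Set (ℕ × ℕ) :=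
  {p | 1 ≤ p.1 ∧ p.1 ≤ k ∧ 1 ≤ p.2 ∧ p.2 ≤ p.1 ∧ Nat.gcd p.2 p.1 = 1}

/-- The function on `ℝ` whose graph joins the consecutive points `(n, g n)`, `n ∈ ℤ`, by line
segments. -/
noncomputable def lineGraph (g : ℤ → ℝ) (x : ℝ) : ℝ :=
  g ⌊x⌋ + Int.fract x * (g (⌊x⌋ + 1) - g ⌊x⌋)

/-- The local peaks of the line graph of `g` over the interval `[0, b]`: the points of the line
graph at which it has a local maximum. -/
def localPeaks (g : ℤ → ℝ) (b : ℝ) : Set (ℝ × ℝ) :=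
  {P | P.1 ∈ Set.Icc 0 b ∧ P.2 = lineGraph g P.1 ∧
    IsLocalMaxOn (lineGraph g) (Set.Icc 0 b) P.1}

/-! Write `f = ⌊k/q⌋` and `m = k mod q`. An edge of `G(n,k)` is an integer `l` in the window `[n +
k, n + 2k)`, read modulo `k + 1` at its source and modulo `k` at its target; row `l` of the matrix
has the v-part of its source and the u-part of its target. Hence a directed cycle yields a
telescoping relation between rows, and disjoint cycles yield independent relations
(`le_bandNullity_eta`). Conversely, a kernel vector gives a function of mean zero that is constant
along edges, so a connected graph forces nullity `0` (`bandNullity_eq_zero_of_connected`).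

For `n = η(q,j)` the vertices, in cyclic order, form `q` blocks of `f` consecutive vertices, indexed
by `x` mod `q`, together with `m + 1` single vertices, one directly after each block `a * j`, `0 ≤ a
≤ m`. Edges carry block `x` to block `x + j`, preserving the index `w` inside the block. This gives
`f` cycles of length `q`, and the single vertices form a path starting at `k`. Moving the window by
`f` in either direction replaces `f` edges, and the new ones string the path and all the cycles into
one path. So the nullity is at least `f` at `η` and is `0` at `η ± f`. Consecutive matrices differ
in one row, so the nullity is `1`-Lipschitz and must be the triangle `f - |n - η|`
(`bandNullity_eq_sub_abs`).

Triangles with different peaks cannot overlap, their bases lie in `[0, k² + k]`, and their total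
base length is `2 ∑ φ(q) ⌊k/q⌋ = k(k + 1)`; hence they tile the interval (`exists_peak_interval`),
and the local peaks can be read off.

For the band matrix, encode a vector as a polynomial and multiply by `bandPoly k`, whose roots are
the nodes of the matrix. Kernel vectors are those with vanishing middle coefficients, and the
remaining outer coefficients form a left kernel vector of `V(n,k)` (`nullity_bandMatrix`). -/

/-- The number of integers `y ∈ [0, x)` (counted with sign) congruent to `a * j` modulo `q`. -/
def crossings (q j a : ℕ) (x : ℤ) : ℤ :=
  ((a : ℤ) * j) / q - ((a : ℤ) * j - x) / q

/-- The lift of the vertices to a cover of the circle `ℤ / (k + 1)`: the `x`-th block consists of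
the integers `domPos x - w` with `1 ≤ w ≤ k / q`. -/
def domPos (k q j : ℕ) (x : ℤ) : ℤ :=
  x * (k / q : ℕ) - 1 + ∑ a ∈ Finset.range (k % q + 1), crossings q j a x

/-- The lift of the vertices to a cover of the circle `ℤ / k`. -/
def codPos (k q j : ℕ) (x : ℤ) : ℤ :=
  x * (k / q : ℕ) + ∑ a ∈ Finset.range (k % q), crossings q j (a + 1) x

/-- The vertex with index `w` in the block `x mod q`. -/
def blockVertex (k q j : ℕ) (x w : ℤ) : ℤ := domPos k q j ((x - 1) % q + 1) - w

/-! ### Block positions on the circles of lengths `k + 1` and `k` -/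

section positions

variable {k q j : ℕ}

theorem crossings_add_mul (hq : 1 ≤ q) (a : ℕ) (x t : ℤ) :
    crossings q j a (x + q * t) = crossings q j a x + t := by
  unfold crossings
  have : (a : ℤ) * j - (x + q * t) = ((a : ℤ) * j - x) + q * (-t) := by ring
  rw [this, Int.add_mul_ediv_left _ _ (by positivity)]
  ring

theorem crossings_succ (hq : 1 ≤ q) (a : ℕ) (x : ℤ) :
    crossings q j a (x + 1) =
      crossings q j a x + if (q : ℤ) ∣ (a : ℤ) * j - x then 1 else 0 := by
  unfold crossings
  have hq' : (0 : ℤ) < q := by positivity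
  generalize (a : ℤ) * j / q = c
  have e : (a : ℤ) * j - (x + 1) = ((a : ℤ) * j - x) - 1 := by ring
  rw [e]
  generalize (a : ℤ) * j - x = y
  split_ifs with h
  · obtain ⟨t, rfl⟩ := h
    have : (q * t - 1 : ℤ) = (q - 1) + q * (t - 1) := by ring
    rw [this, Int.add_mul_ediv_left _ _ hq'.ne', Int.ediv_eq_zero_of_lt (by omega) (by omega),
      Int.mul_ediv_cancel_left _ hq'.ne']
    ring
  · have h1 : 0 < y % q := by
      have := Int.emod_nonneg y hq'.ne'
      have : y % q ≠ 0 := fun h' => h (Int.dvd_of_emod_eq_zero h')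
      omega
    have h2 := Int.emod_lt_of_pos y hq'
    have h3 := Int.emod_add_mul_ediv y q
    have : y - 1 = (y % q - 1) + q * (y / q) := by linarith
    rw [this, Int.add_mul_ediv_left _ _ hq'.ne', Int.ediv_eq_zero_of_lt (by omega) (by omega)]
    ring

theorem crossings_eq_ite (hq : 1 ≤ q) (a : ℕ) {x : ℤ} (h1 : 1 ≤ x) (h2 : x ≤ q) :
    crossings q j a x = if (((a * j) % q : ℕ) : ℤ) < x then 1 else 0 := by
  unfold crossings
  have hq' : (0 : ℤ) < q := by positivity
  push_cast
  generalize (a : ℤ) * j = y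
  have h3 := Int.emod_nonneg y hq'.ne'
  have h4 := Int.emod_lt_of_pos y hq'
  have h5 := Int.emod_add_mul_ediv y q
  generalize y / q = d at *
  generalize y % q = e at *
  split_ifs with h
  · have : y - x = (e - x + q) + q * (d - 1) := by linarith
    rw [this, Int.add_mul_ediv_left _ _ hq'.ne', Int.ediv_eq_zero_of_lt (by omega) (by omega)]
    ring
  · have : y - x = (e - x) + q * d := by linarith
    rw [this, Int.add_mul_ediv_left _ _ hq'.ne', Int.ediv_eq_zero_of_lt (by omega) (by omega)]
    ring

theorem div_mul_add_mod (k q : ℕ) : (q : ℤ) * (k / q : ℕ) + (k % q : ℕ) = k := by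
  exact_mod_cast Nat.div_add_mod k q

theorem domPos_add_mul (hq : 1 ≤ q) (x t : ℤ) :
    domPos k q j (x + q * t) = domPos k q j x + (k + 1) * t := by
  unfold domPos
  simp only [crossings_add_mul hq, Finset.sum_add_distrib, Finset.sum_const, Finset.card_range,
    nsmul_eq_mul]
  have := div_mul_add_mod k q
  push_cast at this ⊢
  linear_combination t * this

theorem codPos_add_mul (hq : 1 ≤ q) (x t : ℤ) :
    codPos k q j (x + q * t) = codPos k q j x + k * t := by
  unfold codPos
  simp only [crossings_add_mul hq, Finset.sum_add_distrib, Finset.sum_const, Finset.card_range,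
    nsmul_eq_mul]
  have := div_mul_add_mod k q
  push_cast at this ⊢
  linear_combination t * this

theorem crossings_zero (a : ℕ) : crossings q j a 0 = 0 := by simp [crossings]

theorem domPos_zero : domPos k q j 0 = -1 := by
  simp [domPos, crossings_zero]

theorem domPos_self (hq : 1 ≤ q) : domPos k q j q = k := by
  have := domPos_add_mul (k := k) (j := j) hq 0 1
  rw [domPos_zero] at this
  simpa using this

/-- On the first period the progression `a = 0` has been crossed exactly once, which cancels the
offset `-1`. -/
theorem domPos_eq_codPos (hq : 1 ≤ q) {x : ℤ} (h1 : 1 ≤ x) (h2 : x ≤ q) :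
    domPos k q j x = codPos k q j x := by
  unfold domPos codPos
  rw [Finset.sum_range_succ', crossings_eq_ite hq 0 h1 h2]
  simp only [zero_mul, Nat.zero_mod]
  rw [if_pos (by push_cast; omega)]
  ring

/-- Passing from `x` to `x + j` turns the progression `a` into `a + 1`. The two sums then differ
only in the term `a = k % q`, whose quotient is `-1` throughout this window and cancels the offset.
This is why the shift by `j` follows the edges. -/
theorem domPos_eq_codPos_add (hq : 1 ≤ q) {x : ℤ} (h1 : ((k % q : ℕ) : ℤ) * j + 1 ≤ x)
    (h2 : x ≤ ((k % q : ℕ) : ℤ) * j + q) :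
    domPos k q j x = codPos k q j (x + j) - j * (k / q : ℕ) := by
  have hq' : (0 : ℤ) < q := by positivity
  unfold domPos codPos crossings
  rw [Finset.sum_sub_distrib, Finset.sum_sub_distrib, Finset.sum_range_succ',
    Finset.sum_range_succ (fun a : ℕ => ((a : ℤ) * j - x) / q)]
  have e : (((k % q : ℕ) : ℤ) * j - x) / q = -1 := by
    have : ((k % q : ℕ) : ℤ) * j - x = (((k % q : ℕ) : ℤ) * j - x + q) + q * (-1) := by ring
    rw [this, Int.add_mul_ediv_left _ _ hq'.ne', Int.ediv_eq_zero_of_lt (by omega) (by omega)]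
    ring
  rw [e]
  have e2 : ∀ a : ℕ, ((a + 1 : ℕ) : ℤ) * j - (x + j) = (a : ℤ) * j - x := by
    intro a; push_cast; ring
  simp only [e2]
  simp only [Nat.cast_zero, zero_mul, Int.zero_ediv]
  ring

/-- Each block takes `k / q` places; the filter counts the free places after block `x`, at most one
when `j` and `q` are coprime. The free places hold the path vertices. -/
theorem domPos_succ (hq : 1 ≤ q) (x : ℤ) :
    domPos k q j (x + 1) = domPos k q j x + (k / q : ℕ) +
      (((Finset.range (k % q + 1)).filter fun a : ℕ => (q : ℤ) ∣ (a : ℤ) * j - x).card : ℤ) := by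
  unfold domPos
  simp only [crossings_succ hq, Finset.sum_add_distrib, Finset.sum_boole]
  push_cast
  ring

theorem dvd_sub_mul_iff (hj : Nat.gcd j q = 1) (a b : ℤ) :
    (q : ℤ) ∣ a * j - b * j ↔ (q : ℤ) ∣ a - b := by
  rw [← sub_mul]
  have : IsCoprime (q : ℤ) (j : ℤ) := by
    rw [Nat.isCoprime_iff_coprime]; exact Nat.Coprime.symm hj
  exact ⟨fun h => this.dvd_of_dvd_mul_right h, fun h => h.mul_right _⟩

theorem eq_of_dvd_mul_sub (hj : Nat.gcd j q = 1) {a b : ℕ} (ha : a < q)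
    (hb : b < q) (h : (q : ℤ) ∣ (a : ℤ) * j - b * j) : a = b := by
  rw [dvd_sub_mul_iff hj] at h
  obtain ⟨t, ht⟩ := h
  have : -1 < t := by
    by_contra hc
    nlinarith
  have : t < 1 := by
    by_contra hc
    nlinarith
  have : t = 0 := by omega
  subst this
  omega

theorem card_filter_dvd_le (hq : 1 ≤ q) (hj : Nat.gcd j q = 1) (x : ℤ) :
    ((Finset.range (k % q + 1)).filter fun a : ℕ => (q : ℤ) ∣ (a : ℤ) * j - x).card ≤ 1 := by
  rw [Finset.card_le_one]
  intro a ha b hb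
  simp only [Finset.mem_filter, Finset.mem_range] at ha hb
  have := Nat.mod_lt k hq
  refine eq_of_dvd_mul_sub hj (by omega) (by omega) ?_
  have := dvd_sub ha.2 hb.2
  ring_nf at this ⊢
  exact this

theorem domPos_add_le (hq : 1 ≤ q) (x : ℤ) :
    domPos k q j x + (k / q : ℕ) ≤ domPos k q j (x + 1) := by
  rw [domPos_succ hq]; omega

theorem domPos_mono (hq : 1 ≤ q) : Monotone (domPos k q j) :=
  monotone_int_of_le_succ fun x => 
    le_trans (le_add_of_nonneg_right (by positivity)) (domPos_add_le hq x)

theorem domPos_add_le_of_lt (hq : 1 ≤ q) {x y : ℤ} (h : x < y) :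
    domPos k q j x + (k / q : ℕ) ≤ domPos k q j y :=
  (domPos_add_le hq x).trans (domPos_mono hq (by omega))

theorem domPos_succ_le (hq : 1 ≤ q) (hj : Nat.gcd j q = 1) (x : ℤ) :
    domPos k q j (x + 1) ≤ domPos k q j x + (k / q : ℕ) + 1 := by
  rw [domPos_succ hq]
  have := card_filter_dvd_le (k := k) hq hj x
  omega

theorem domPos_succ_of_dvd (hq : 1 ≤ q) (hj : Nat.gcd j q = 1) {x : ℤ} {a : ℕ} (ha : a ≤ k % q)
    (h : (q : ℤ) ∣ (a : ℤ) * j - x) :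
    domPos k q j (x + 1) = domPos k q j x + (k / q : ℕ) + 1 := by
  refine le_antisymm (domPos_succ_le hq hj x) ?_
  rw [domPos_succ hq]
  have : 0 < ((Finset.range (k % q + 1)).filter
      fun a : ℕ => (q : ℤ) ∣ (a : ℤ) * j - x).card := by
    rw [Finset.card_pos]
    exact ⟨a, by simp only [Finset.mem_filter, Finset.mem_range]; exact ⟨by omega, h⟩⟩
  omega

theorem exists_dvd_of_domPos_lt (hq : 1 ≤ q) {x : ℤ}
    (h : domPos k q j x + (k / q : ℕ) < domPos k q j (x + 1)) :
    ∃ a : ℕ, a ≤ k % q ∧ (q : ℤ) ∣ (a : ℤ) * j - x := by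
  rw [domPos_succ hq] at h
  have : 0 < ((Finset.range (k % q + 1)).filter
      fun a : ℕ => (q : ℤ) ∣ (a : ℤ) * j - x).card := by omega
  rw [Finset.card_pos] at this
  obtain ⟨a, ha⟩ := this
  simp only [Finset.mem_filter, Finset.mem_range] at ha
  exact ⟨a, by omega, ha.2⟩

/-- Pair `a` with `M - a`, where `M = k % q + 1`. The addition of `a * j` and `(M - a) * j` modulo
`q` has no carry exactly when the residue of `a * j` is at most that of `M * j`, which is the
condition counted by `s`. -/
theorem sCount_add (hq : 1 ≤ q) :
    (sCount k q j : ℤ) + (k % q : ℕ) * ((((k % q + 1) * j / q : ℕ)) : ℤ) =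
      (k % q : ℕ) + 2 * ∑ a ∈ Finset.range (k % q), ((((a + 1) * j / q : ℕ)) : ℤ) := by
  have hrefl := Finset.sum_range_reflect
    (fun a => ((((a + 1) * j / q : ℕ)) : ℤ)) (k % q)
  have hs : (sCount k q j : ℤ) = ∑ a ∈ Finset.range (k % q),
      if ((a + 1) * j) % q ≤ ((k % q + 1) * j) % q then (1 : ℤ) else 0 := by
    unfold sCount
    rw [Finset.card_filter, Finset.range_eq_Ico,
      Finset.sum_Ico_add' (fun a => if (a * j) % q ≤ ((k % q + 1) * j) % q then (1 : ℤ) else 0)]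
    push_cast
    rfl
  have key : ∀ a ∈ Finset.range (k % q),
      (if ((a + 1) * j) % q ≤ ((k % q + 1) * j) % q then (1 : ℤ) else 0)
        + ((((k % q + 1) * j / q : ℕ)) : ℤ)
      = 1 + ((((k % q - 1 - a + 1) * j / q : ℕ)) : ℤ) + ((((a + 1) * j / q : ℕ)) : ℤ) := by
    intro a ha
    rw [Finset.mem_range] at ha
    have e : (k % q + 1) * j = (a + 1) * j + (k % q - 1 - a + 1) * j := by
      rw [← add_mul]; congr 1; omega
    rw [e]
    generalize (a + 1) * j = y
    generalize (k % q - 1 - a + 1) * j = z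
    rw [Nat.add_div hq, Nat.add_mod]
    have h1 := Nat.mod_lt y hq
    have h2 := Nat.mod_lt z hq
    by_cases h : q ≤ y % q + z % q
    · rw [if_pos h, Nat.mod_eq_sub_mod h, Nat.mod_eq_of_lt (a := y % q + z % q - q) (by omega),
        if_neg (by omega)]
      push_cast; ring
    · rw [if_neg h, Nat.mod_eq_of_lt (a := y % q + z % q) (by omega), if_pos (by omega)]
      push_cast; ring
  have := Finset.sum_congr rfl key
  simp only [Finset.sum_add_distrib, Finset.sum_const, Finset.card_range, nsmul_eq_mul] at this
  rw [hs]
  rw [hrefl] at this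
  linarith

/-- Reversing the order of summation turns the second quotient into `⌊(-a j - 1)/q⌋ = -1 - ⌊a j/q⌋`,
so both halves contribute the same sum of floors. -/
theorem sum_crossings_last (hq : 1 ≤ q) :
    ∑ a ∈ Finset.range (k % q + 1), crossings q j a (((k % q : ℕ) : ℤ) * j + 1) =
      (k % q : ℕ) + 1 + 2 * ∑ a ∈ Finset.range (k % q), ((((a + 1) * j / q : ℕ)) : ℤ) := by
  have hq' : (0 : ℤ) < q := by positivity
  unfold crossings
  rw [Finset.sum_sub_distrib,
    ← Finset.sum_range_reflect (fun a : ℕ => ((a : ℤ) * j - (((k % q : ℕ) : ℤ) * j + 1)) / q)]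
  have e : ∀ a ∈ Finset.range (k % q + 1),
      (((k % q + 1 - 1 - a : ℕ) : ℤ) * j - (((k % q : ℕ) : ℤ) * j + 1)) / q
        = -1 - (a : ℤ) * j / q := by
    intro a ha
    rw [Finset.mem_range] at ha
    rw [Nat.cast_sub (by omega), Nat.add_sub_cancel]
    have h := Int.emod_add_mul_ediv ((a : ℤ) * j) q
    have h3 := Int.emod_nonneg ((a : ℤ) * j) hq'.ne'
    have h4 := Int.emod_lt_of_pos ((a : ℤ) * j) hq'
    have : (((k % q : ℕ) : ℤ) - a) * j - (((k % q : ℕ) : ℤ) * j + 1)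
        = (q - 1 - ((a : ℤ) * j) % q) + q * (-1 - (a : ℤ) * j / q) := by
      linear_combination h
    rw [this, Int.add_mul_ediv_left _ _ hq'.ne', Int.ediv_eq_zero_of_lt (by omega) (by omega)]
    ring
  rw [Finset.sum_congr rfl e]
  simp only [Finset.sum_sub_distrib, Finset.sum_const, Finset.card_range, nsmul_eq_mul]
  rw [Finset.sum_range_succ']
  push_cast
  simp
  ring

/-- Gives the closed formula its geometric meaning: `η` is the `n` whose window of edges opens with
the block `(k % q) * j + 1`. -/
theorem eta_eq (hq : 1 ≤ q) :
    eta k q j = (k + 1) * (j * (k / q : ℕ)) + domPos k q j (((k % q : ℕ) : ℤ) * j + 1)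
      - (k / q : ℕ) - k := by
  have hs := sCount_add (k := k) (j := j) hq
  have hd : (k + 1) * j / q = j * (k / q) + (k % q + 1) * j / q := by
    have : (k + 1) * j = (k % q + 1) * j + q * (j * (k / q)) := by
      conv_lhs => rw [← Nat.div_add_mod k q]
      ring
    rw [this, Nat.add_mul_div_left _ _ hq, add_comm]
  have hm : ((((k % q + 1) * j) % q : ℕ) : ℤ) =
      ((k % q + 1 : ℕ) : ℤ) * j - q * (((k % q + 1) * j / q : ℕ) : ℤ) := by
    have := Nat.mod_add_div ((k % q + 1) * j) q
    zify at this ⊢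
    linear_combination this
  unfold eta domPos
  rw [sum_crossings_last hq, hd, hm]
  have hk := div_mul_add_mod k q
  generalize (((k % q + 1) * j / q : ℕ)) = F at *
  generalize (k / q : ℕ) = f at *
  generalize (k % q : ℕ) = m at *
  push_cast at hs ⊢
  linear_combination hs - F * hk

theorem tCount_eq (hq : 1 ≤ q) {r : ℕ} (h : 1 ≤ (r * j) % q) :
    (tCount k r q j : ℤ) =
      ∑ a ∈ Finset.range (k % q + 1), crossings q j a (((r * j) % q : ℕ) : ℤ) := by
  have := Nat.mod_lt (r * j) hq
  rw [Finset.sum_congr rfl fun a _ => crossings_eq_ite (j := j) hq a (by exact_mod_cast h)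
    (by omega)]
  unfold tCount
  have e : Finset.Icc 0 (k % q) = Finset.range (k % q + 1) := by
    ext a; simp only [Finset.mem_Icc, Finset.mem_range]; omega
  rw [Finset.card_filter, e]
  simp only [Nat.cast_sum, Nat.cast_ite, Nat.cast_one, Nat.cast_zero, Nat.cast_lt]

/-! ### Vertices -/

/-- One `t` serves both circles, because the normalised representative of `x` lies in `[1, q]`,
where `domPos` and `codPos` agree. -/
theorem blockVertex_eq (hq : 1 ≤ q) (x w : ℤ) :
    ∃ t : ℤ, blockVertex k q j x w = domPos k q j x - w + (k + 1) * t ∧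
      blockVertex k q j x w = codPos k q j x - w + k * t := by
  have hq' : (0 : ℤ) < q := by positivity
  have h1 := Int.emod_nonneg (x - 1) hq'.ne'
  have h2 := Int.emod_lt_of_pos (x - 1) hq'
  have h3 := Int.emod_add_mul_ediv (x - 1) q
  have e : (x - 1) % q + 1 = x + q * (-((x - 1) / q)) := by linear_combination h3
  refine ⟨-((x - 1) / q), ?_, ?_⟩
  · unfold blockVertex
    rw [e, domPos_add_mul hq]
    ring
  · unfold blockVertex
    rw [domPos_eq_codPos hq (by omega) (by omega), e, codPos_add_mul hq]
    ring

theorem blockVertex_congr (w : ℤ) {x y : ℤ} (h : (q : ℤ) ∣ x - y) :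
    blockVertex k q j x w = blockVertex k q j y w := by
  unfold blockVertex
  have : (x - 1) % q = (y - 1) % q := by
    exact Int.emod_eq_emod_iff_emod_sub_eq_zero.2
      (Int.emod_eq_zero_of_dvd (by ring_nf at h ⊢; exact h))
  rw [this]

theorem blockVertex_nonneg (hq : 1 ≤ q) (x : ℤ) {w : ℤ} (hw : w ≤ (k / q : ℕ)) :
    0 ≤ blockVertex k q j x w := by
  have hq' : (0 : ℤ) < q := by positivity
  have h1 := Int.emod_nonneg (x - 1) hq'.ne'
  unfold blockVertex
  have h2 := domPos_succ (k := k) (j := j) hq 0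
  have h3 : 0 < ((Finset.range (k % q + 1)).filter
      fun a : ℕ => (q : ℤ) ∣ (a : ℤ) * j - 0).card := by
    rw [Finset.card_pos]
    exact ⟨0, by simp⟩
  have h4 := domPos_mono (k := k) (j := j) hq (show 0 + 1 ≤ (x - 1) % q + 1 by omega)
  rw [domPos_zero] at h2
  omega

theorem blockVertex_le (hq : 1 ≤ q) (x w : ℤ) : blockVertex k q j x w ≤ k - w := by
  have hq' : (0 : ℤ) < q := by positivity
  have h1 := Int.emod_lt_of_pos (x - 1) hq'
  unfold blockVertex
  have h4 := domPos_mono (k := k) (j := j) hq (show (x - 1) % q + 1 ≤ q by omega)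
  rw [domPos_self hq] at h4
  omega

theorem blockVertex_self (hq : 1 ≤ q) (w : ℤ) : blockVertex k q j 0 w = k - w := by
  rw [blockVertex_congr w (show (q : ℤ) ∣ 0 - q by simp)]
  unfold blockVertex
  rw [Int.emod_eq_of_lt (by omega) (by omega), sub_add_cancel, domPos_self hq]

/-- Vertices with equal values have the same block and the same index. -/
theorem blockVertex_injective (hq : 1 ≤ q) {x y w v : ℤ} (hw : 0 ≤ w) (hw' : w ≤ (k / q : ℕ))
    (hv : 1 ≤ v) (hv' : v ≤ (k / q : ℕ)) (h : blockVertex k q j x w = blockVertex k q j y v) :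
    w = 0 ∨ ((q : ℤ) ∣ x - y ∧ w = v) := by
  have hq' : (0 : ℤ) < q := by positivity
  by_cases hw0 : w = 0
  · exact Or.inl hw0
  right
  have key : (x - 1) % q = (y - 1) % q := by
    unfold blockVertex at h
    rcases lt_trichotomy ((x - 1) % (q : ℤ)) ((y - 1) % q) with hlt | heq | hgt
    · have := domPos_add_le_of_lt (k := k) (j := j) hq
        (show (x - 1) % (q : ℤ) + 1 < (y - 1) % q + 1 by omega)
      omega
    · exact heq
    · have := domPos_add_le_of_lt (k := k) (j := j) hq
        (show (y - 1) % (q : ℤ) + 1 < (x - 1) % q + 1 by omega)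
      omega
  refine ⟨?_, ?_⟩
  · have := Int.dvd_of_emod_eq_zero (Int.emod_eq_emod_iff_emod_sub_eq_zero.1 key)
    ring_nf at this ⊢
    exact this
  · unfold blockVertex at h
    rw [key] at h
    omega

theorem domPos_one (hq : 1 ≤ q) (hj : Nat.gcd j q = 1) : domPos k q j 1 = (k / q : ℕ) := by
  have := domPos_succ_of_dvd (k := k) hq hj (x := 0) (a := 0) (by omega) (by simp)
  rw [domPos_zero] at this
  rw [← zero_add (1 : ℤ), this]
  ring

/-- A discrete intermediate value argument between `domPos 1 = k / q` and `domPos (q + 1) = k + k /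
q + 1`. -/
theorem exists_domPos_le_lt (hq : 1 ≤ q) (hj : Nat.gcd j q = 1) {v : ℤ} (h0 : 0 ≤ v)
    (hv : v ≤ k) :
    ∃ x : ℤ, 1 ≤ x ∧ x ≤ q ∧ domPos k q j x ≤ v + (k / q : ℕ) ∧
      v + (k / q : ℕ) < domPos k q j (x + 1) := by
  by_contra hc
  push Not at hc
  have : ∀ n : ℕ, n ≤ q → domPos k q j (n + 1) ≤ v + (k / q : ℕ) := by
    intro n hn
    induction n with
    | zero => rw [Nat.cast_zero, zero_add, domPos_one hq hj]; omega
    | succ n ih =>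
      have := ih (by omega)
      exact_mod_cast hc (n + 1) (by omega) (by omega) this
  have h1 := this q le_rfl
  have h2 := domPos_succ_of_dvd (k := k) hq hj (x := q) (a := 0) (by omega) (by simp)
  rw [domPos_self hq] at h2
  omega

/-- Every vertex is the vertex of a block with positive index or lies on the path. -/
theorem exists_blockVertex_eq (hq : 1 ≤ q) (hj : Nat.gcd j q = 1) {v : ℤ} (h0 : 0 ≤ v)
    (hv : v ≤ k) :
    (∃ x w : ℤ, 1 ≤ w ∧ w ≤ (k / q : ℕ) ∧ v = blockVertex k q j x w) ∨
      ∃ a : ℕ, a ≤ k % q ∧ v = blockVertex k q j (a * j) 0 := by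
  obtain ⟨x, hx1, hx2, h1, h2⟩ := exists_domPos_le_lt hq hj h0 hv
  have e : ∀ w, blockVertex k q j x w = domPos k q j x - w := by
    intro w
    unfold blockVertex
    rw [Int.emod_eq_of_lt (by omega) (by omega), sub_add_cancel]
  have h3 := domPos_succ_le (k := k) hq hj x
  by_cases hw : v < domPos k q j x
  · exact Or.inl ⟨x, domPos k q j x - v, by omega, by omega, by rw [e]; ring⟩
  · right
    -- Here `v = domPos x`, and the next block starts one place later than it would without a gap.
    obtain ⟨a, ha, hd⟩ := exists_dvd_of_domPos_lt (k := k) (j := j) hq (x := x) (by omega)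
    exact ⟨a, ha, by rw [blockVertex_congr 0 hd, e]; omega⟩

theorem cVertex_eq (hq : 1 ≤ q) (hj : Nat.gcd j q = 1) {r : ℕ} (hr : r < q) (w : ℕ) :
    cVertex k q j w r = blockVertex k q j ((r : ℤ) * j) w := by
  unfold cVertex
  split_ifs with h0
  · subst h0
    rw [Nat.cast_zero, zero_mul, blockVertex_self hq]
  · have h1 : 1 ≤ (r * j) % q := by
      by_contra hc
      have hd : q ∣ r * j := Nat.dvd_of_mod_eq_zero (by omega)
      have := Nat.le_of_dvd (by omega) ((Nat.Coprime.symm hj).dvd_of_dvd_mul_right hd)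
      omega
    have h2 := Nat.mod_lt (r * j) hq
    have hd : (q : ℤ) ∣ (r : ℤ) * j - ((r * j) % q : ℕ) := by
      push_cast
      exact Int.dvd_self_sub_of_emod_eq rfl
    rw [blockVertex_congr _ hd, tCount_eq hq h1]
    unfold blockVertex
    rw [Int.emod_eq_of_lt (by omega) (by omega), sub_add_cancel]
    unfold domPos
    ring

/-! ### Edges -/

/-- `a → b` is an edge of the graph `G(n,k)`, on integers. -/
def Linked (n : ℤ) (k : ℕ) (a b : ℤ) : Prop :=
  ∃ l : ℤ, n + k ≤ l ∧ l < n + 2 * k ∧ a = l % (k + 1) ∧ b = l % k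

theorem bandGraph_adj_iff {n : ℤ} (a b : Fin (k + 1)) :
    (bandGraph n k).Adj a b ↔ Linked n k (a : ℕ) (b : ℕ) := by
  unfold bandGraph Linked
  have h1 : ∀ l : ℤ, (l - (k + 1)) % (k + 1) = l % ((k : ℤ) + 1) := fun l => by
    rw [Int.sub_emod_right]
  have h2 : ∀ l : ℤ, (l - k) % k = l % (k : ℤ) := fun l => by rw [Int.sub_emod_right]
  constructor
  · rintro ⟨i, hi1, hi2, ha, hb⟩
    -- This `l` exceeds the source expression `i + n - 2` by `k + 1` and the target expression `i +
    -- n - 1` by `k`.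
    refine ⟨i + n + k - 1, by omega, by omega, ?_, ?_⟩
    · rw [ha, ← h1 (i + n + k - 1)]; congr 1; ring
    · rw [hb, ← h2 (i + n + k - 1)]; congr 1; ring
  · rintro ⟨l, hl1, hl2, ha, hb⟩
    refine ⟨l - n - k + 1, by omega, by omega, ?_, ?_⟩
    · rw [ha, ← h1 l]; congr 1; ring
    · rw [hb, ← h2 l]; congr 1; ring

theorem eq_emod_of_eq_add_mul {a l t d : ℤ} (h0 : 0 ≤ a) (h1 : a < d) (h : a = l + d * t) :
    a = l % d := by
  rw [← Int.emod_eq_of_lt h0 h1, h, Int.add_mul_emod_self_left]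

/-- The lift of the edge leaving the `w`-th vertex of the block `x`. -/
def edgeLift (k q j : ℕ) (x w : ℤ) : ℤ := domPos k q j x - w + (k + 1) * (j * (k / q : ℕ))

theorem blockVertex_eq_emod (hq : 1 ≤ q) (x : ℤ) {w : ℤ} (hw : 0 ≤ w)
    (hw' : w ≤ (k / q : ℕ)) : blockVertex k q j x w = edgeLift k q j x w % (k + 1) := by
  obtain ⟨t, ht, -⟩ := blockVertex_eq (k := k) (j := j) hq x w
  have h1 := blockVertex_nonneg (k := k) (j := j) hq x hw'
  have h2 := blockVertex_le (k := k) (j := j) hq x w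
  refine eq_emod_of_eq_add_mul (t := t - j * (k / q : ℕ)) h1 (by omega) ?_
  rw [ht, edgeLift]
  ring

/-- By `domPos_eq_codPos_add`, the lift equals `codPos (x + j) - w + k * j * (k / q)`. Thus one
integer represents block `x` modulo `k + 1` and block `x + j` modulo `k`. -/
theorem blockVertex_add_eq_emod (hq : 1 ≤ q) {x : ℤ} (hx1 : ((k % q : ℕ) : ℤ) * j + 1 ≤ x)
    (hx2 : x ≤ ((k % q : ℕ) : ℤ) * j + q) {w : ℤ} (hw' : w ≤ (k / q : ℕ))
    (hlt : blockVertex k q j (x + j) w < k) :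
    blockVertex k q j (x + j) w = edgeLift k q j x w % k := by
  obtain ⟨t, -, ht⟩ := blockVertex_eq (k := k) (j := j) hq (x + j) w
  have h1 := blockVertex_nonneg (k := k) (j := j) hq (x + j) hw'
  refine eq_emod_of_eq_add_mul (t := t - j * (k / q : ℕ)) h1 hlt ?_
  rw [ht, edgeLift, domPos_eq_codPos_add hq hx1 hx2]
  ring

/-- At `w = k / q` this is `η + k`, the first integer of the window of `G(η,k)`. -/
theorem edgeLift_first (hq : 1 ≤ q) (w : ℤ) :
    edgeLift k q j (((k % q : ℕ) : ℤ) * j + 1) w = eta k q j + k + (k / q : ℕ) - w := by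
  rw [edgeLift, eta_eq hq]
  ring

/-- At `w = 1` this is the last integer of the window; at `w = 0` it is one past the end, so the
last path vertex has no outgoing edge. -/
theorem edgeLift_last (hq : 1 ≤ q) (hj : Nat.gcd j q = 1) (w : ℤ) :
    edgeLift k q j (((k % q : ℕ) : ℤ) * j + q) w = eta k q j + 2 * k - w := by
  have h1 := domPos_succ_of_dvd (k := k) hq hj (x := ((k % q : ℕ) : ℤ) * j) (a := k % q) le_rfl
    (by simp)
  have h2 := domPos_add_mul (k := k) (j := j) hq (((k % q : ℕ) : ℤ) * j) 1
  rw [mul_one] at h2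
  rw [edgeLift, eta_eq hq, h1, h2]
  ring

/-- The representative of `x` modulo `q` in the window `[(k % q) * j + 1, (k % q) * j + q]`. -/
theorem exists_window_rep (hq : 1 ≤ q) (x : ℤ) :
    ∃ y : ℤ, ((k % q : ℕ) : ℤ) * j + 1 ≤ y ∧ y ≤ ((k % q : ℕ) : ℤ) * j + q ∧ (q : ℤ) ∣ x - y := by
  have hq' : (0 : ℤ) < q := by positivity
  refine ⟨((k % q : ℕ) : ℤ) * j + 1 + (x - (((k % q : ℕ) : ℤ) * j + 1)) % q, ?_, ?_, ?_⟩
  · have := Int.emod_nonneg (x - (((k % q : ℕ) : ℤ) * j + 1)) hq'.ne'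
    omega
  · have := Int.emod_lt_of_pos (x - (((k % q : ℕ) : ℤ) * j + 1)) hq'
    omega
  · rw [← sub_sub]
    exact Int.dvd_self_sub_of_emod_eq rfl

end positions

/-! ### Edges of `G(n,k)` at `n = η` and `n = η ± ⌊k/q⌋` -/

section edges

variable {k q j : ℕ}

theorem edgeLift_mono (hq : 1 ≤ q) (w : ℤ) {x y : ℤ} (h : x ≤ y) :
    edgeLift k q j x w ≤ edgeLift k q j y w := by
  unfold edgeLift
  have := domPos_mono (k := k) (j := j) hq h
  omega

theorem edgeLift_add_le (hq : 1 ≤ q) (w : ℤ) {x y : ℤ} (h : x < y) :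
    edgeLift k q j x w + (k / q : ℕ) ≤ edgeLift k q j y w := by
  unfold edgeLift
  have := domPos_add_le_of_lt (k := k) (j := j) hq h
  omega

theorem linked_of_window (hq : 1 ≤ q) {n x w : ℤ} (hx1 : ((k % q : ℕ) : ℤ) * j + 1 ≤ x)
    (hx2 : x ≤ ((k % q : ℕ) : ℤ) * j + q) (hw : 0 ≤ w) (hw' : w ≤ (k / q : ℕ))
    (hlt : blockVertex k q j (x + j) w < k) (h1 : n + k ≤ edgeLift k q j x w)
    (h2 : edgeLift k q j x w < n + 2 * k) :
    Linked n k (blockVertex k q j x w) (blockVertex k q j (x + j) w) :=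
  ⟨edgeLift k q j x w, h1, h2, blockVertex_eq_emod hq x hw hw',
    blockVertex_add_eq_emod hq hx1 hx2 hw' hlt⟩

theorem blockVertex_lt (hq : 1 ≤ q) (x : ℤ) {w : ℤ} (hw : 1 ≤ w) : blockVertex k q j x w < k := by
  have := blockVertex_le (k := k) (j := j) hq x w
  omega

theorem blockVertex_zero_lt (hq : 1 ≤ q) (hqk : q ≤ k) {x : ℤ} (hx : ¬ (q : ℤ) ∣ x) :
    blockVertex k q j x 0 < k := by
  have hq' : (0 : ℤ) < q := by positivity
  have hf : 1 ≤ k / q := Nat.div_pos hqk hq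
  have h1 := Int.emod_lt_of_pos (x - 1) hq'
  have h2 : (x - 1) % q + 1 < q := by
    by_contra hc
    apply hx
    have h3 := Int.emod_add_mul_ediv (x - 1) q
    exact ⟨(x - 1) / q + 1, by linarith⟩
  have := domPos_add_le_of_lt (k := k) (j := j) hq h2
  rw [domPos_self hq] at this
  unfold blockVertex
  omega

theorem not_dvd_path (hj : Nat.gcd j q = 1) {a : ℕ} (ha : 1 ≤ a) (ha' : a < q) :
    ¬ (q : ℤ) ∣ (a : ℤ) * j := by
  intro h
  have := eq_of_dvd_mul_sub (a := a) (b := 0) hj ha' (by omega) (by simpa using h)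
  omega

theorem blockVertex_path_lt (hq : 1 ≤ q) (hqk : q ≤ k) (hj : Nat.gcd j q = 1) {a : ℕ}
    (ha : a < k % q) : blockVertex k q j (((a + 1 : ℕ) : ℤ) * j) 0 < k :=
  blockVertex_zero_lt hq hqk (not_dvd_path hj (by omega) (by have := Nat.mod_lt k hq; omega))

/-- The window representative of a path vertex other than the last one. -/
theorem path_window (hq : 1 ≤ q) (hj : Nat.gcd j q = 1) {a : ℕ} (ha : a < k % q) :
    ∃ y : ℤ, ((k % q : ℕ) : ℤ) * j + 1 ≤ y ∧ y < ((k % q : ℕ) : ℤ) * j + q ∧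
      (q : ℤ) ∣ (a : ℤ) * j - y := by
  obtain ⟨y, h1, h2, h3⟩ := exists_window_rep (k := k) (j := j) hq ((a : ℤ) * j)
  refine ⟨y, h1, lt_of_le_of_ne h2 ?_, h3⟩
  rintro rfl
  have hm := Nat.mod_lt k hq
  have := eq_of_dvd_mul_sub (a := a) (b := k % q) hj (by omega) hm (by
    rw [← sub_sub, dvd_sub_self_right] at h3
    exact h3)
  omega

/-- A free place follows the block `y`, so the next block is `k / q + 1` further on. The resulting
slack keeps the path edges inside the window when it moves down by `k / q`. -/
theorem edgeLift_path_add (hq : 1 ≤ q) (hj : Nat.gcd j q = 1) {a : ℕ} (ha : a < k % q) {y : ℤ}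
    (hy : y < ((k % q : ℕ) : ℤ) * j + q) (hd : (q : ℤ) ∣ (a : ℤ) * j - y) :
    edgeLift k q j y 0 + (k / q : ℕ) < eta k q j + 2 * k := by
  have h1 := domPos_succ_of_dvd (k := k) hq hj ha.le hd
  have h2 := edgeLift_mono (k := k) (j := j) hq 0 (show y + 1 ≤ ((k % q : ℕ) : ℤ) * j + q by omega)
  rw [edgeLift_last hq hj] at h2
  unfold edgeLift at h2 ⊢
  omega

theorem shift_congr (x y : ℤ) (h : (q : ℤ) ∣ x - y) : (q : ℤ) ∣ (x + j) - (y + j) := by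
  simpa using h

/-- The edges of `G(η(q,j),k)` along the cycles. -/
theorem linked_block (hq : 1 ≤ q) (hj : Nat.gcd j q = 1) (x : ℤ) {w : ℤ} (hw : 1 ≤ w)
    (hw' : w ≤ (k / q : ℕ)) :
    Linked (eta k q j) k (blockVertex k q j x w) (blockVertex k q j (x + j) w) := by
  obtain ⟨y, h1, h2, h3⟩ := exists_window_rep (k := k) (j := j) hq x
  rw [blockVertex_congr w h3, blockVertex_congr w (shift_congr x y h3)]
  have e1 := edgeLift_mono (k := k) (j := j) hq w h1
  have e2 := edgeLift_mono (k := k) (j := j) hq w h2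
  rw [edgeLift_first hq] at e1
  rw [edgeLift_last hq hj] at e2
  exact linked_of_window hq h1 h2 (by omega) hw' (blockVertex_lt hq _ hw) (by omega) (by omega)

/-- The edges along the path, in the graphs `G(n,k)` with `|n - η(q,j)| ≤ ⌊k/q⌋`. -/
theorem linked_path (hq : 1 ≤ q) (hqk : q ≤ k) (hj : Nat.gcd j q = 1) {n : ℤ}
    (hn : |n - eta k q j| ≤ (k / q : ℕ)) {a : ℕ} (ha : a < k % q) :
    Linked n k (blockVertex k q j (a * j) 0) (blockVertex k q j (((a + 1 : ℕ) : ℤ) * j) 0) := by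
  obtain ⟨y, h1, h2, h3⟩ := path_window hq hj ha
  have h4 : (q : ℤ) ∣ ((a + 1 : ℕ) : ℤ) * j - (y + j) := by
    push_cast
    rw [add_mul, one_mul]
    exact shift_congr _ _ h3
  have hlt := blockVertex_path_lt hq hqk hj ha
  rw [blockVertex_congr 0 h4] at hlt
  rw [blockVertex_congr 0 h3, blockVertex_congr 0 h4]
  have e1 := edgeLift_mono (k := k) (j := j) hq 0 h1
  rw [edgeLift_first hq] at e1
  have e2 := edgeLift_path_add hq hj ha h2 h3
  rw [abs_le] at hn
  exact linked_of_window hq h1 h2.le le_rfl (by positivity) hlt (by omega) (by omega)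

/-- Moving the window up by `k / q` loses only the lifts from `η + k` to `η + k + k / q - 1`, which
are the block edges leaving `(k % q) * j + 1`. -/
theorem linked_add_block (hq : 1 ≤ q) (hj : Nat.gcd j q = 1) {x : ℤ}
    (hx : ¬ (q : ℤ) ∣ x - (((k % q : ℕ) : ℤ) * j + 1)) {w : ℤ} (hw : 1 ≤ w)
    (hw' : w ≤ (k / q : ℕ)) :
    Linked (eta k q j + (k / q : ℕ)) k (blockVertex k q j x w)
      (blockVertex k q j (x + j) w) := by
  obtain ⟨y, h1, h2, h3⟩ := exists_window_rep (k := k) (j := j) hq x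
  rw [blockVertex_congr w h3, blockVertex_congr w (shift_congr x y h3)]
  have hne : ((k % q : ℕ) : ℤ) * j + 1 < y := lt_of_le_of_ne h1 (by rintro rfl; exact hx h3)
  have e1 := edgeLift_add_le (k := k) (j := j) hq w hne
  have e2 := edgeLift_mono (k := k) (j := j) hq w h2
  rw [edgeLift_first hq] at e1
  rw [edgeLift_last hq hj] at e2
  exact linked_of_window hq h1 h2 (by omega) hw' (blockVertex_lt hq _ hw) (by omega) (by omega)

/-- Moving the window down by `k / q` loses only the lifts from `η + 2 k - k / q` to `η + 2 k - 1`,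
which are the block edges leaving `(k % q) * j`. -/
theorem linked_sub_block (hq : 1 ≤ q) (hj : Nat.gcd j q = 1) {x : ℤ}
    (hx : ¬ (q : ℤ) ∣ x - ((k % q : ℕ) : ℤ) * j) {w : ℤ} (hw : 1 ≤ w)
    (hw' : w ≤ (k / q : ℕ)) :
    Linked (eta k q j - (k / q : ℕ)) k (blockVertex k q j x w)
      (blockVertex k q j (x + j) w) := by
  obtain ⟨y, h1, h2, h3⟩ := exists_window_rep (k := k) (j := j) hq x
  rw [blockVertex_congr w h3, blockVertex_congr w (shift_congr x y h3)]
  have hne : y < ((k % q : ℕ) : ℤ) * j + q := lt_of_le_of_ne h2 (by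
    rintro rfl
    rw [← sub_sub, dvd_sub_self_right] at h3
    exact hx h3)
  have e1 := edgeLift_mono (k := k) (j := j) hq w h1
  have e2 := edgeLift_add_le (k := k) (j := j) hq w hne
  rw [edgeLift_first hq] at e1
  rw [edgeLift_last hq hj] at e2
  exact linked_of_window hq h1 h2 (by omega) hw' (blockVertex_lt hq _ hw) (by omega) (by omega)

theorem blockVertex_last_block (hq : 1 ≤ q) (hj : Nat.gcd j q = 1) {w : ℤ} (hw : 0 ≤ w)
    (hw' : w ≤ (k / q : ℕ)) :
    blockVertex k q j (((k % q : ℕ) : ℤ) * j) w = (eta k q j + 2 * k - w) % (k + 1) := by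
  rw [← edgeLift_last hq hj, ← blockVertex_eq_emod hq _ hw hw']
  exact blockVertex_congr w (by simp)

/-- Each gained lift is a lost lift plus `k`. The target is unchanged; the source moves back by one
modulo `k + 1`, so its index rises by one, or it is the end of the path when `w = k / q`. -/
theorem linked_add_of_eq (hq : 1 ≤ q) {w v : ℤ} (hw : 1 ≤ w)
    (hw' : w ≤ (k / q : ℕ)) {b : ℤ} (hv : b = (eta k q j + 2 * k + (k / q : ℕ) - w) % (k + 1))
    (hvw : v = ((k % q : ℕ) : ℤ) * j + 1) :
    Linked (eta k q j + (k / q : ℕ)) k b (blockVertex k q j (v + j) w) := by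
  subst hvw
  have hfk : k / q ≤ k := Nat.div_le_self k q
  refine ⟨eta k q j + 2 * k + (k / q : ℕ) - w, by omega, by omega, hv, ?_⟩
  rw [blockVertex_add_eq_emod hq le_rfl (by omega) hw' (blockVertex_lt hq _ hw), edgeLift_first hq,
    ← Int.add_emod_right]
  congr 1
  ring

theorem linked_add_path (hq : 1 ≤ q) (hqk : q ≤ k) (hj : Nat.gcd j q = 1) :
    Linked (eta k q j + (k / q : ℕ)) k (blockVertex k q j (((k % q : ℕ) : ℤ) * j) 0)
      (blockVertex k q j (((k % q : ℕ) : ℤ) * j + 1 + j) (k / q : ℕ)) := by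
  have hf : 1 ≤ k / q := Nat.div_pos hqk hq
  refine linked_add_of_eq hq (by omega) le_rfl ?_ rfl
  rw [blockVertex_last_block hq hj le_rfl (by positivity)]
  congr 1
  ring

theorem linked_add_succ (hq : 1 ≤ q) {w : ℤ} (hw : 1 ≤ w)
    (hw' : w + 1 ≤ (k / q : ℕ)) :
    Linked (eta k q j + (k / q : ℕ)) k
      (blockVertex k q j (((k % q : ℕ) : ℤ) * j + 1) (w + 1))
      (blockVertex k q j (((k % q : ℕ) : ℤ) * j + 1 + j) w) := by
  refine linked_add_of_eq hq hw (by omega) ?_ rfl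
  rw [blockVertex_eq_emod hq _ (by omega) hw', edgeLift_first hq, ← Int.add_emod_right]
  congr 1
  ring

/-- The edges `(block of (k % q) * j, w - 1) → (block of (k % q + 1) * j, w)` of the graph
`G(η(q,j) - ⌊k/q⌋,k)`. -/
theorem linked_sub_succ (hq : 1 ≤ q) (hj : Nat.gcd j q = 1) {w : ℤ} (hw : 1 ≤ w)
    (hw' : w ≤ (k / q : ℕ)) :
    Linked (eta k q j - (k / q : ℕ)) k (blockVertex k q j (((k % q : ℕ) : ℤ) * j) (w - 1))
      (blockVertex k q j (((k % q : ℕ) : ℤ) * j + j) w) := by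
  have hfk : k / q ≤ k := Nat.div_le_self k q
  -- This is the lost lift `η + 2 k - w` minus `k`: the target is the same and the source index
  -- drops by one, index `0` being the end of the path.
  refine ⟨eta k q j + k - w, by omega, by omega, ?_, ?_⟩
  · rw [blockVertex_last_block hq hj (by omega) (by omega), ← Int.add_emod_right (eta k q j + k - w)]
    congr 1
    ring
  · have h : (q : ℤ) ∣ (((k % q : ℕ) : ℤ) * j + j) - (((k % q : ℕ) : ℤ) * j + q + j) := by
      rw [show (((k % q : ℕ) : ℤ) * j + j) - (((k % q : ℕ) : ℤ) * j + q + j) = -(q : ℤ) by ring]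
      simp
    rw [blockVertex_congr w h, blockVertex_add_eq_emod hq (by omega) le_rfl hw'
      (blockVertex_lt hq _ hw), edgeLift_last hq hj, ← Int.add_emod_right (eta k q j + k - w)]
    congr 1
    ring

theorem eq_of_emod_eq {n : ℤ} {l l' : ℤ} (h1 : n ≤ l) (h2 : l < n + (k + 1))
    (h1' : n ≤ l') (h2' : l' < n + (k + 1)) (h : l % ((k : ℤ) + 1) = l' % (k + 1)) : l = l' := by
  obtain ⟨t, ht⟩ := Int.dvd_of_emod_eq_zero (Int.emod_eq_emod_iff_emod_sub_eq_zero.1 h)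
  have h3 : t < 1 := by
    by_contra hc
    nlinarith
  have h4 : -1 < t := by
    by_contra hc
    nlinarith
  have : t = 0 := by omega
  subst this
  omega

/-- The window has only `k` integers, which are distinct modulo `k + 1`. -/
theorem Linked.right_unique {n a b b' : ℤ} (h : Linked n k a b) (h' : Linked n k a b') :
    b = b' := by
  obtain ⟨l, h1, h2, h3, h4⟩ := h
  obtain ⟨l', h1', h2', h3', h4'⟩ := h'
  have := eq_of_emod_eq (n := n + k) h1 (by omega) h1' (by omega) (h3.symm.trans h3')
  rw [h4, h4', this]

/-- The last vertex of the path has no outgoing edge. -/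
theorem not_linked_path_end (hq : 1 ≤ q) (hj : Nat.gcd j q = 1) (b : ℤ) :
    ¬ Linked (eta k q j) k (blockVertex k q j (((k % q : ℕ) : ℤ) * j) 0) b := by
  rintro ⟨l, h1, h2, h3, -⟩
  rw [blockVertex_last_block hq hj le_rfl (by positivity)] at h3
  -- Among the `k + 1` integers from `η + k` on, the only lift of this vertex is `η + 2 k`, just
  -- outside the window.
  have := eq_of_emod_eq (k := k) (n := eta k q j + k) (by omega) (by omega) h1 (by omega) h3
  omega

/-- Every residue modulo `q` is a multiple of `j`. -/
theorem exists_dvd_sub_mul (hq : 1 ≤ q) (hj : Nat.gcd j q = 1) (x : ℤ) :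
    ∃ r : ℕ, r < q ∧ (q : ℤ) ∣ x - r * j := by
  have hq' : (0 : ℤ) < q := by positivity
  obtain ⟨u, v, huv⟩ : IsCoprime (j : ℤ) (q : ℤ) := Nat.isCoprime_iff_coprime.2 hj
  have h1 := Int.emod_nonneg (x * u) hq'.ne'
  have h2 := Int.emod_lt_of_pos (x * u) hq'
  have h3 := Int.emod_add_mul_ediv (x * u) q
  refine ⟨((x * u) % q).toNat, by omega, ?_⟩
  rw [Int.toNat_of_nonneg h1]
  exact ⟨x * v + (x * u) / q * j, by linear_combination (-x) * huv + (-j : ℤ) * h3⟩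

end edges

/-! ### The cycles of `G(η(q,j),k)` -/

section cycles

variable {k q j : ℕ}

/-- The vertex `blockVertex k q j x w` as an element of the vertex type of the graph. -/
def blockFin (k q j : ℕ) (x w : ℤ) : Fin (k + 1) := Fin.ofNat (k + 1) (blockVertex k q j x w).toNat

theorem coe_blockFin (hq : 1 ≤ q) (x : ℤ) {w : ℤ} (hw : 0 ≤ w) (hw' : w ≤ (k / q : ℕ)) :
    ((blockFin k q j x w : ℕ) : ℤ) = blockVertex k q j x w := by
  have h1 := blockVertex_nonneg (k := k) (j := j) hq x hw'
  have h2 := blockVertex_le (k := k) (j := j) hq x w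
  unfold blockFin
  rw [Fin.val_ofNat, Nat.mod_eq_of_lt (by omega), Int.toNat_of_nonneg h1]

/-- The cycle `c(0) → c(1) → ⋯ → c(q - 1) → c(0)` on the vertex type of the graph. -/
def blockCycle (k q j w : ℕ) : Cycle (Fin (k + 1)) :=
  (((List.range q).map fun r : ℕ => blockFin k q j ((r : ℤ) * j) w : List (Fin (k + 1))) :
    Cycle (Fin (k + 1)))

theorem map_blockCycle (hq : 1 ≤ q) (hj : Nat.gcd j q = 1) {w : ℕ} (hw : w ≤ k / q) :
    (blockCycle k q j w).map (fun v : Fin (k + 1) => ((v : ℕ) : ℤ)) = cCycle k q j w := by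
  unfold blockCycle cCycle
  rw [Cycle.map_coe, List.map_map]
  congr 1
  apply List.map_congr_left
  intro r hr
  rw [List.mem_range] at hr
  rw [Function.comp_apply, coe_blockFin hq _ (by positivity) (by exact_mod_cast hw),
    cVertex_eq hq hj hr]

theorem mem_blockCycle {w : ℕ} {v : Fin (k + 1)} :
    v ∈ blockCycle k q j w ↔ ∃ r < q, blockFin k q j ((r : ℕ) * j) w = v := by
  unfold blockCycle
  simp [Cycle.mem_coe_iff]

theorem blockFin_mem_blockCycle (hq : 1 ≤ q) (hj : Nat.gcd j q = 1) (x : ℤ) (w : ℕ) :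
    blockFin k q j x w ∈ blockCycle k q j w := by
  obtain ⟨r, hr, hd⟩ := exists_dvd_sub_mul hq hj x
  rw [mem_blockCycle]
  exact ⟨r, hr, by unfold blockFin; rw [blockVertex_congr _ hd]⟩

theorem blockFin_injective (hq : 1 ≤ q) {x y : ℤ} {w v : ℕ} (hw : 1 ≤ w) (hw' : w ≤ k / q)
    (hv : 1 ≤ v) (hv' : v ≤ k / q) (h : blockFin k q j x w = blockFin k q j y v) :
    (q : ℤ) ∣ x - y ∧ w = v := by
  have h' : ((blockFin k q j x w : ℕ) : ℤ) = (blockFin k q j y v : ℕ) := by rw [h]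
  rw [coe_blockFin hq _ (by positivity) (by exact_mod_cast hw'),
    coe_blockFin hq _ (by positivity) (by exact_mod_cast hv')] at h'
  have := blockVertex_injective hq (by positivity) (by exact_mod_cast hw')
    (by exact_mod_cast hv) (by exact_mod_cast hv') h'
  omega

theorem blockCycle_mem_cycles (hq : 1 ≤ q) (hj : Nat.gcd j q = 1) {w : ℕ} (hw : 1 ≤ w)
    (hw' : w ≤ k / q) : blockCycle k q j w ∈ (bandGraph (eta k q j) k).cycles := by
  refine ⟨?_, ?_, ?_⟩
  · intro h
    have := blockFin_mem_blockCycle (k := k) hq hj 0 w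
    rw [h] at this
    exact Cycle.notMem_nil _ this
  · unfold blockCycle
    rw [Cycle.nodup_coe_iff]
    refine List.Nodup.map_on ?_ List.nodup_range
    intro a ha b hb hab
    rw [List.mem_range] at ha hb
    exact eq_of_dvd_mul_sub hj ha hb (blockFin_injective hq hw hw' hw hw' hab).1
  · have hadj : ∀ x : ℤ, (bandGraph (eta k q j) k).Adj (blockFin k q j x w)
        (blockFin k q j (x + j) w) := by
      intro x
      rw [bandGraph_adj_iff, coe_blockFin hq _ (by positivity) (by exact_mod_cast hw'),
        coe_blockFin hq _ (by positivity) (by exact_mod_cast hw')]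
      exact linked_block hq hj x (by exact_mod_cast hw) (by exact_mod_cast hw')
    unfold blockCycle
    rw [← Cycle.map_coe, Cycle.chain_map]
    obtain ⟨p, rfl⟩ : ∃ p, q = p + 1 := ⟨q - 1, by omega⟩
    rw [Cycle.chain_range_succ]
    refine ⟨?_, ?_⟩
    · have h := hadj ((p : ℤ) * j)
      have e : blockFin k (p + 1) j ((p : ℤ) * j + j) w
          = blockFin k (p + 1) j (((0 : ℕ) : ℤ) * j) w := by
        unfold blockFin
        rw [blockVertex_congr]
        exact ⟨j, by push_cast; ring⟩
      rwa [e] at h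
    · intro m _
      have h := hadj ((m : ℤ) * j)
      have e : (m : ℤ) * j + j = ((m.succ : ℕ) : ℤ) * j := by push_cast; ring
      rwa [e] at h

/-- Two orbit segments of a functional relation with the same start that first return to `v` at
their ends agree. -/
theorem List.IsChain.eq_of_functional {V : Type*} {R : V → V → Prop}
    (hR : ∀ a b c, R a b → R a c → b = c) {v : V} :
    ∀ (l₁ l₂ : List V) (a : V), v ∉ l₁ → v ∉ l₂ → (a :: (l₁ ++ [v])).IsChain R →
      (a :: (l₂ ++ [v])).IsChain R → l₁ = l₂
  | [], [], _, _, _, _, _ => rfl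
  | [], b :: l, a, _, h2, c1, c2 => by
    simp only [List.nil_append, List.cons_append, List.isChain_cons_cons] at c1 c2
    exact absurd (hR _ _ _ c1.1 c2.1) (fun h => h2 (by simp [h]))
  | b :: l, [], a, h1, _, c1, c2 => by
    simp only [List.nil_append, List.cons_append, List.isChain_cons_cons] at c1 c2
    exact absurd (hR _ _ _ c2.1 c1.1) (fun h => h1 (by simp [h]))
  | b :: l, c :: l', a, h1, h2, c1, c2 => by
    simp only [List.cons_append, List.isChain_cons_cons] at c1 c2
    obtain rfl := hR _ _ _ c1.1 c2.1
    rw [List.IsChain.eq_of_functional hR l l' b (fun h => h1 (by simp [h]))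
      (fun h => h2 (by simp [h])) c1.2 c2.2]

theorem Cycle.exists_cons_of_mem {V : Type*} {C : Cycle V} {v : V} (h : v ∈ C) :
    ∃ l : List V, C = ((v :: l : List V) : Cycle V) := by
  induction C using Quotient.inductionOn' with
  | h L =>
    obtain ⟨s, t, rfl⟩ := List.append_of_mem (Cycle.mem_coe_iff.1 h)
    refine ⟨t ++ s, ?_⟩
    rw [← List.cons_append]
    exact Cycle.coe_eq_coe.2 List.isRotated_append

theorem Digraph.eq_of_mem_cycles {V : Type*} {G : Digraph V}
    (hG : ∀ a b c, G.Adj a b → G.Adj a c → b = c) {C D : Cycle V} (hC : C ∈ G.cycles)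
    (hD : D ∈ G.cycles) {v : V} (hvC : v ∈ C) (hvD : v ∈ D) : C = D := by
  obtain ⟨l, rfl⟩ := Cycle.exists_cons_of_mem hvC
  obtain ⟨l', rfl⟩ := Cycle.exists_cons_of_mem hvD
  obtain ⟨-, h1, h2⟩ := hC
  obtain ⟨-, h1', h2'⟩ := hD
  rw [Cycle.nodup_coe_iff, List.nodup_cons] at h1 h1'
  rw [Cycle.chain_coe_cons] at h2 h2'
  rw [List.IsChain.eq_of_functional hG l l' v h1.1 h1'.1 h2 h2']

theorem Digraph.exists_adj_of_mem_cycles {V : Type*} {G : Digraph V} {C : Cycle V}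
    (hC : C ∈ G.cycles) {v : V} (hv : v ∈ C) : ∃ u ∈ C, G.Adj v u := by
  obtain ⟨l, rfl⟩ := Cycle.exists_cons_of_mem hv
  obtain ⟨-, -, h⟩ := hC
  rw [Cycle.chain_coe_cons] at h
  cases l with
  | nil => exact ⟨v, by simp, by simpa using h⟩
  | cons u l =>
    rw [List.cons_append, List.isChain_cons_cons] at h
    exact ⟨u, by simp, h.1⟩

theorem bandGraph_right_unique {n : ℤ} (a b c : Fin (k + 1)) (h : (bandGraph n k).Adj a b)
    (h' : (bandGraph n k).Adj a c) : b = c := by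
  rw [bandGraph_adj_iff] at h h'
  have := h.right_unique h'
  exact Fin.ext (by exact_mod_cast this)

/-- A cycle through a path vertex contains its only successor, hence follows the path to its end,
where there is no successor. The induction is on the distance `i` to that end. -/
theorem path_notMem_cycles (hq : 1 ≤ q) (hqk : q ≤ k) (hj : Nat.gcd j q = 1)
    {C : Cycle (Fin (k + 1))} (hC : C ∈ (bandGraph (eta k q j) k).cycles) (i : ℕ) :
    ∀ a : ℕ, a + i = k % q → blockFin k q j ((a : ℤ) * j) 0 ∉ C := by
  induction i with
  | zero =>
    rintro a rfl hmem
    obtain ⟨u, -, hu⟩ := Digraph.exists_adj_of_mem_cycles hC hmem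
    rw [bandGraph_adj_iff, coe_blockFin hq _ le_rfl (by positivity)] at hu
    exact not_linked_path_end hq hj _ hu
  | succ i ih =>
    intro a ha hmem
    obtain ⟨u, huC, hu⟩ := Digraph.exists_adj_of_mem_cycles hC hmem
    rw [bandGraph_adj_iff, coe_blockFin hq _ le_rfl (by positivity)] at hu
    have := hu.right_unique (linked_path hq hqk hj (by rw [sub_self, abs_zero]; positivity) (show a < k % q by omega))
    rw [← coe_blockFin hq _ le_rfl (by positivity)] at this
    rw [Fin.ext (by exact_mod_cast this : (u : ℕ) = _)] at huC
    exact ih (a + 1) (by omega) huC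

/-- Each vertex lies in a block cycle or on the path; the path is excluded, and with out-degree at
most one a cycle is determined by any of its vertices. -/
theorem cycles_bandGraph_eta (hq : 1 ≤ q) (hqk : q ≤ k) (hj : Nat.gcd j q = 1) :
    (bandGraph (eta k q j) k).cycles = blockCycle k q j '' Set.Icc 1 (k / q) := by
  apply Set.Subset.antisymm
  · intro C hC
    obtain ⟨v, hv⟩ : ∃ v, v ∈ C := by
      induction C using Quotient.inductionOn' with
      | h L =>
        cases L with
        | nil => exact absurd rfl hC.1
        | cons v l => exact ⟨v, Cycle.mem_coe_iff.2 (by simp)⟩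
    rcases exists_blockVertex_eq (k := k) (v := ((v : ℕ) : ℤ)) hq hj (by positivity) (by omega) with
      ⟨x, w, h1, h2, h⟩ | ⟨a, ha, h⟩
    · lift w to ℕ using by omega
      refine ⟨w, ⟨by omega, by omega⟩, ?_⟩
      rw [← coe_blockFin hq _ (by omega) h2] at h
      refine Digraph.eq_of_mem_cycles bandGraph_right_unique
        (blockCycle_mem_cycles hq hj (by omega) (by omega)) hC
        (blockFin_mem_blockCycle hq hj x w) ?_
      have e : v = blockFin k q j x w := Fin.ext (by exact_mod_cast h)
      rwa [← e]
    · rw [← coe_blockFin hq _ le_rfl (by positivity)] at h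
      rw [Fin.ext (by exact_mod_cast h : (v : ℕ) = _)] at hv
      exact absurd hv (path_notMem_cycles hq hqk hj hC (k % q - a) a (by omega))
  · rintro _ ⟨w, ⟨h1, h2⟩, rfl⟩
    exact blockCycle_mem_cycles hq hj h1 h2

theorem injOn_blockCycle (hq : 1 ≤ q) (hj : Nat.gcd j q = 1) :
    Set.InjOn (blockCycle k q j) (Set.Icc 1 (k / q)) := by
  rintro w ⟨h1, h2⟩ v ⟨h3, h4⟩ h
  have := blockFin_mem_blockCycle (k := k) hq hj 0 w
  rw [h, mem_blockCycle] at this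
  obtain ⟨r, -, hr⟩ := this
  exact (blockFin_injective hq h3 h4 h1 h2 hr).2.symm

theorem injOn_cCycle (hq : 1 ≤ q) (hj : Nat.gcd j q = 1) :
    Set.InjOn (cCycle k q j) (Set.Icc 1 (k / q)) := by
  rintro w ⟨h1, h2⟩ v ⟨h3, h4⟩ h
  rw [← map_blockCycle hq hj h2, ← map_blockCycle hq hj h4] at h
  have hmem : ((blockFin k q j 0 w : ℕ) : ℤ) ∈
      (blockCycle k q j w).map (fun v : Fin (k + 1) => ((v : ℕ) : ℤ)) :=
    Cycle.mem_map.2 ⟨_, blockFin_mem_blockCycle hq hj 0 w, rfl⟩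
  rw [h, Cycle.mem_map] at hmem
  obtain ⟨u, hu, hu'⟩ := hmem
  rw [Fin.ext (by exact_mod_cast hu' : (u : ℕ) = _), mem_blockCycle] at hu
  obtain ⟨r, -, hr⟩ := hu
  exact (blockFin_injective hq h3 h4 h1 h2 hr).2.symm

theorem length_blockCycle (w : ℕ) : (blockCycle k q j w).length = q := by
  simp [blockCycle, Cycle.length_coe]

theorem image_map_cycles_bandGraph_eta (hq : 1 ≤ q) (hqk : q ≤ k) (hj : Nat.gcd j q = 1) :
    (fun C : Cycle (Fin (k + 1)) => C.map fun v : Fin (k + 1) => ((v : ℕ) : ℤ)) ''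
      (bandGraph (eta k q j) k).cycles = cCycle k q j '' Set.Icc 1 (k / q) := by
  rw [cycles_bandGraph_eta hq hqk hj, Set.image_image]
  exact Set.image_congr fun w hw => map_blockCycle hq hj hw.2

theorem ncard_cycles_bandGraph_eta (hq : 1 ≤ q) (hqk : q ≤ k) (hj : Nat.gcd j q = 1) :
    (bandGraph (eta k q j) k).cycles.ncard = k / q := by
  rw [cycles_bandGraph_eta hq hqk hj, (injOn_blockCycle hq hj).ncard_image,
    Set.ncard_eq_toFinset_card']
  simp

theorem length_of_mem_cycles_bandGraph_eta (hq : 1 ≤ q) (hqk : q ≤ k) (hj : Nat.gcd j q = 1)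
    {C : Cycle (Fin (k + 1))} (hC : C ∈ (bandGraph (eta k q j) k).cycles) : C.length = q := by
  rw [cycles_bandGraph_eta hq hqk hj] at hC
  obtain ⟨w, -, rfl⟩ := hC
  exact length_blockCycle w

end cycles

/-! ### The nullity near `η(q,j)` -/

section nullity

theorem rank_add_nullity {K ι : Type*} [Field K] [Fintype ι] [DecidableEq ι] (M : Matrix ι ι K) :
    M.rank + nullity M = Fintype.card ι := by
  have := M.mulVecLin.finrank_range_add_finrank_ker
  rw [Module.finrank_fintype_fun_eq_card] at this
  exact this

theorem nullity_transpose {K ι : Type*} [Field K] [Fintype ι] [DecidableEq ι] (M : Matrix ι ι K) :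
    nullity M.transpose = nullity M := by
  have h1 := rank_add_nullity M
  have h2 := rank_add_nullity M.transpose
  rw [Matrix.rank_transpose] at h2
  omega

theorem finrank_le_finrank_inf_ker_add_one {K V : Type*} [Field K] [AddCommGroup V] [Module K V]
    [FiniteDimensional K V] (E : Submodule K V) (φ : V →ₗ[K] K) :
    Module.finrank K E ≤ Module.finrank K (E ⊓ LinearMap.ker φ : Submodule K V) + 1 := by
  have h1 := Submodule.finrank_sup_add_finrank_inf_eq E (LinearMap.ker φ)
  have h2 := φ.finrank_range_add_finrank_ker
  have h3 := Submodule.finrank_le (LinearMap.range φ)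
  have h4 := Submodule.finrank_le (E ⊔ LinearMap.ker φ)
  rw [Module.finrank_self] at h3
  omega

variable {k : ℕ} {ζ ξ : ℂ}

/-- The vector `(u(ℓ) | v(ℓ))`. -/
noncomputable def rowVec (k : ℕ) (ζ ξ : ℂ) (l : ℤ) : Fin k ⊕ Fin k → ℂ :=
  Sum.elim (uRow k ζ l) (vRow k ξ l)

theorem bigMatrix_inl (n : ℤ) (i : Fin k) :
    bigMatrix k ζ ξ n (Sum.inl i) = rowVec k ζ ξ ((i : ℕ) : ℤ) := by
  ext (c | c) <;> rfl

theorem bigMatrix_inr (n : ℤ) (i : Fin k) :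
    bigMatrix k ζ ξ n (Sum.inr i) = rowVec k ζ ξ ((k : ℤ) + n + ((i : ℕ) : ℤ)) := by
  ext (c | c) <;> rfl

/-- The linear functional given by the row `(u(ℓ) | v(ℓ))`. -/
noncomputable def rowFunctional (k : ℕ) (ζ ξ : ℂ) (l : ℤ) : (Fin k ⊕ Fin k → ℂ) →ₗ[ℂ] ℂ :=
  dotProductBilin ℂ ℂ (rowVec k ζ ξ l)

theorem mem_ker_bigMatrix {n : ℤ} {z : Fin k ⊕ Fin k → ℂ} :
    z ∈ LinearMap.ker (bigMatrix k ζ ξ n).mulVecLin ↔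
      (∀ l : ℤ, 0 ≤ l → l < k → rowFunctional k ζ ξ l z = 0) ∧
        ∀ l : ℤ, n + k ≤ l → l < n + 2 * k → rowFunctional k ζ ξ l z = 0 := by
  rw [LinearMap.mem_ker, Matrix.mulVecLin_apply]
  constructor
  · intro h
    refine ⟨fun l h1 h2 => ?_, fun l h1 h2 => ?_⟩
    · have := congrFun h (Sum.inl ⟨l.toNat, by omega⟩)
      rw [Matrix.mulVec, bigMatrix_inl] at this
      simpa [rowFunctional, Int.toNat_of_nonneg h1] using this
    · have := congrFun h (Sum.inr ⟨(l - n - k).toNat, by omega⟩)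
      rw [Matrix.mulVec, bigMatrix_inr] at this
      simp only [Int.toNat_of_nonneg (show 0 ≤ l - n - k by omega)] at this
      rw [show (k : ℤ) + n + (l - n - k) = l by ring] at this
      exact this
  · rintro ⟨h1, h2⟩
    ext (i | i)
    · rw [Matrix.mulVec, bigMatrix_inl]
      exact h1 _ (by positivity) (by omega)
    · rw [Matrix.mulVec, bigMatrix_inr]
      exact h2 _ (by omega) (by omega)

/-- The matrices for `n` and `n + 1` share all rows but one each. Both kernels arise from the common
solution space `E` by imposing one more linear condition. -/
theorem abs_bandNullity_succ_sub_le (n : ℤ) :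
    |(bandNullity k ζ ξ (n + 1) : ℤ) - bandNullity k ζ ξ n| ≤ 1 := by
  let E : Submodule ℂ (Fin k ⊕ Fin k → ℂ) :=
    (⨅ l ∈ Set.Ico (0 : ℤ) k, LinearMap.ker (rowFunctional k ζ ξ l)) ⊓
      ⨅ l ∈ Set.Ico (n + 1 + k) (n + 2 * k), LinearMap.ker (rowFunctional k ζ ξ l)
  have hE : ∀ z, z ∈ E ↔ (∀ l : ℤ, 0 ≤ l → l < k → rowFunctional k ζ ξ l z = 0) ∧
      ∀ l : ℤ, n + 1 + k ≤ l → l < n + 2 * k → rowFunctional k ζ ξ l z = 0 := by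
    intro z
    simp [E, Submodule.mem_iInf]
  have h0 : LinearMap.ker (bigMatrix k ζ ξ n).mulVecLin ≤ E := by
    intro z hz
    rw [mem_ker_bigMatrix] at hz
    rw [hE]
    exact ⟨hz.1, fun l h1 h2 => hz.2 l (by omega) h2⟩
  have h1 : LinearMap.ker (bigMatrix k ζ ξ (n + 1)).mulVecLin ≤ E := by
    intro z hz
    rw [mem_ker_bigMatrix] at hz
    rw [hE]
    exact ⟨hz.1, fun l h1 h2 => hz.2 l (by omega) (by omega)⟩
  have h2 : E ⊓ LinearMap.ker (rowFunctional k ζ ξ (n + k)) ≤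
      LinearMap.ker (bigMatrix k ζ ξ n).mulVecLin := by
    rintro z ⟨hz, hz'⟩
    have hz := (hE z).1 hz
    rw [mem_ker_bigMatrix]
    refine ⟨hz.1, fun l h1 h2 => ?_⟩
    rcases h1.eq_or_lt with rfl | h
    · exact hz'
    · exact hz.2 l (by omega) h2
  have h3 : E ⊓ LinearMap.ker (rowFunctional k ζ ξ (n + 2 * k)) ≤
      LinearMap.ker (bigMatrix k ζ ξ (n + 1)).mulVecLin := by
    rintro z ⟨hz, hz'⟩
    have hz := (hE z).1 hz
    rw [mem_ker_bigMatrix]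
    refine ⟨hz.1, fun l h1 h2 => ?_⟩
    rcases (show l ≤ n + 2 * k by omega).eq_or_lt with rfl | h
    · exact hz'
    · exact hz.2 l (by omega) h
  have a0 := Submodule.finrank_mono h0
  have a1 := Submodule.finrank_mono h1
  have a2 := Submodule.finrank_mono h2
  have a3 := Submodule.finrank_mono h3
  have b2 := finrank_le_finrank_inf_ker_add_one E (rowFunctional k ζ ξ (n + k))
  have b3 := finrank_le_finrank_inf_ker_add_one E (rowFunctional k ζ ξ (n + 2 * k))
  unfold bandNullity nullity
  rw [abs_le]
  omega

theorem bandNullity_le_add (n : ℤ) (t : ℕ) :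
    (bandNullity k ζ ξ n : ℤ) ≤ bandNullity k ζ ξ (n + t) + t ∧
      (bandNullity k ζ ξ (n + t) : ℤ) ≤ bandNullity k ζ ξ n + t := by
  induction t with
  | zero => simp
  | succ t ih =>
    have := abs_bandNullity_succ_sub_le (k := k) (ζ := ζ) (ξ := ξ) (n + t)
    rw [abs_le] at this
    push_cast
    rw [← add_assoc n]
    omega

/-- The nullity is `1`-Lipschitz as a function of `n`. -/
theorem bandNullity_le_add_abs (n n' : ℤ) :
    (bandNullity k ζ ξ n : ℤ) ≤ bandNullity k ζ ξ n' + |n - n'| := by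
  rcases le_total n n' with h | h
  · obtain ⟨t, ht⟩ := Int.eq_ofNat_of_zero_le (sub_nonneg.2 h)
    have := (bandNullity_le_add (k := k) (ζ := ζ) (ξ := ξ) n t).1
    rw [abs_sub_comm, ht, show n' = n + t by omega]
    simpa using this
  · obtain ⟨t, ht⟩ := Int.eq_ofNat_of_zero_le (sub_nonneg.2 h)
    have := (bandNullity_le_add (k := k) (ζ := ζ) (ξ := ξ) n' t).2
    rw [ht, show n = n' + t by omega]
    simpa using this

theorem zpow_mul_emod {ρ : ℂ} {d : ℕ} (hρ : ρ ^ d = 1) (c l : ℤ) :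
    ρ ^ (c * (l % (d : ℤ))) = ρ ^ (c * l) := by
  rcases Nat.eq_zero_or_pos d with rfl | hd
  · simp
  have h0 : ρ ≠ 0 := by
    rintro rfl
    rw [zero_pow hd.ne'] at hρ
    exact zero_ne_one hρ
  have : c * l = c * (l % d) + d * (c * (l / d)) := by
    linear_combination (-c) * Int.emod_add_mul_ediv l d
  rw [this, zpow_add₀ h0, zpow_mul ρ (d : ℤ), zpow_natCast, hρ, one_zpow, mul_one]

theorem uRow_emod (hζ : ζ ^ k = 1) (l : ℤ) : uRow k ζ (l % k) = uRow k ζ l := by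
  ext c
  exact zpow_mul_emod hζ _ l

theorem vRow_emod (hξ : ξ ^ (k + 1) = 1) (l : ℤ) : vRow k ξ (l % (k + 1)) = vRow k ξ l := by
  ext c
  exact_mod_cast zpow_mul_emod hξ _ l

theorem injective_pow_fin {ρ : ℂ} {d : ℕ} (hρ : IsPrimitiveRoot ρ d) {m : ℕ} (hm : m ≤ d) :
    Function.Injective fun l : Fin m => ρ ^ (l : ℕ) := fun a b h =>
  Fin.ext (hρ.pow_inj (by omega) (by omega) h)

theorem sum_vRow_eq_zero (hξ : IsPrimitiveRoot ξ (k + 1)) (c : Fin k) :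
    ∑ l ∈ Finset.range (k + 1), vRow k ξ (l : ℤ) c = 0 := by
  have h1 : ξ ^ ((c : ℕ) + 1) ≠ 1 := hξ.pow_ne_one_of_pos_of_lt (by omega) (by omega)
  have h2 := mul_geom_sum (ξ ^ ((c : ℕ) + 1)) (k + 1)
  rw [← pow_mul, mul_comm _ (k + 1), pow_mul ξ (k + 1), hξ.pow_eq_one, one_pow, sub_self] at h2
  have h3 := (mul_eq_zero.1 h2).resolve_left (sub_ne_zero.2 h1)
  rw [← h3]
  refine Finset.sum_congr rfl fun l _ => ?_
  rw [vRow, ← pow_mul]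
  exact_mod_cast rfl

theorem rowFunctional_apply (l : ℤ) (z : Fin k ⊕ Fin k → ℂ) :
    rowFunctional k ζ ξ l z =
      uRow k ζ l ⬝ᵥ (z ∘ Sum.inl) + vRow k ξ l ⬝ᵥ (z ∘ Sum.inr) := by
  simp [rowFunctional, rowVec, dotProduct]

/-- If the graph `G(n,k)` is connected, then `N(n,k) = 0`. -/
theorem bandNullity_eq_zero_of_connected (hζ : IsPrimitiveRoot ζ k)
    (hξ : IsPrimitiveRoot ξ (k + 1)) {n : ℤ}
    (h : ∀ g : ℤ → ℂ, (∀ a b, Linked n k a b → g a = g b) → ∀ v : ℤ, 0 ≤ v → v ≤ k → g v = g k) :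
    bandNullity k ζ ξ n = 0 := by
  unfold bandNullity nullity
  rw [Submodule.finrank_eq_zero, eq_bot_iff]
  intro z hz
  obtain ⟨hz1, hz2⟩ := mem_ker_bigMatrix.1 hz
  rw [Submodule.mem_bot]
  set x := z ∘ Sum.inl with hx
  set y := z ∘ Sum.inr with hy
  simp only [rowFunctional_apply, ← hx, ← hy] at hz1 hz2
  -- `g` has period `k + 1`, while `u(l) · x` has period `k` and equals `-g` on `[0, k)`. Row `l` of
  -- the window therefore equates `g` at the two ends of the edge `l`.
  set g : ℤ → ℂ := fun l => vRow k ξ l ⬝ᵥ y with hg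
  have hg1 : ∀ l, g (l % (k + 1)) = g l := fun l => by
    simp only [hg, vRow_emod hξ.pow_eq_one]
  have hlink : ∀ a b, Linked n k a b → g a = g b := by
    rintro a b ⟨l, h1, h2, rfl, rfl⟩
    have hk : (0 : ℤ) < k := by omega
    have e1 := hz1 (l % k) (Int.emod_nonneg l hk.ne') (Int.emod_lt_of_pos l hk)
    have e2 := hz2 l h1 h2
    rw [uRow_emod hζ.pow_eq_one] at e1
    rw [hg1]
    exact add_left_cancel (e2.trans e1.symm)
  have hconst := h g hlink
  -- The exponents `1, …, k` give nontrivial characters modulo `k + 1`, so `g` has mean zero; being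
  -- constant, it vanishes.
  have hsum : ∑ l ∈ Finset.range (k + 1), g (l : ℤ) = 0 := by
    simp only [hg, dotProduct]
    rw [Finset.sum_comm]
    refine Finset.sum_eq_zero fun c _ => ?_
    rw [← Finset.sum_mul, sum_vRow_eq_zero hξ, zero_mul]
  have hk0 : g k = 0 := by
    have e : ∀ l ∈ Finset.range (k + 1), g ((l : ℕ) : ℤ) = g k := fun l hl =>
      hconst l (by positivity) (by rw [Finset.mem_range] at hl; omega)
    rw [Finset.sum_congr rfl e, Finset.sum_const, Finset.card_range, nsmul_eq_mul] at hsum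
    exact (mul_eq_zero.1 hsum).resolve_left (by exact_mod_cast Nat.succ_ne_zero k)
  have hg0 : ∀ l : Fin k, vRow k ξ ((l : ℕ) : ℤ) ⬝ᵥ y = 0 := fun l =>
    (hconst _ (by positivity) (by omega)).trans hk0
  have hF0 : ∀ l : Fin k, uRow k ζ ((l : ℕ) : ℤ) ⬝ᵥ x = 0 := fun l => by
    have := hz1 ((l : ℕ) : ℤ) (by positivity) (by omega)
    rwa [hg0, add_zero] at this
  have hx0 : x = 0 := by
    refine Matrix.eq_zero_of_forall_index_sum_pow_mul_eq_zero
      (injective_pow_fin hζ le_rfl) fun l => ?_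
    rw [← hF0 l]
    refine Finset.sum_congr rfl fun c _ => ?_
    rw [uRow, ← pow_mul, mul_comm (l : ℕ)]
    norm_cast
  have hy0 : y = 0 := by
    refine Matrix.eq_zero_of_forall_index_sum_pow_mul_eq_zero
      (injective_pow_fin hξ (Nat.le_succ k)) fun l => ?_
    -- The exponents in `v` start at `1`; factoring out `ξ ^ l` leaves a Vandermonde system.
    have hξ0 : ξ ^ (l : ℕ) ≠ 0 := pow_ne_zero _ (hξ.ne_zero (Nat.succ_ne_zero k))
    refine (mul_eq_zero.1 ?_).resolve_left hξ0
    rw [← hg0 l, Finset.mul_sum]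
    refine Finset.sum_congr rfl fun c _ => ?_
    rw [vRow, ← mul_assoc, ← pow_mul, ← pow_add]
    congr 1
    have : (l : ℕ) + (l : ℕ) * (c : ℕ) = ((c : ℕ) + 1) * (l : ℕ) := by ring
    rw [this]
    norm_cast
  ext (i | i)
  · exact congrFun hx0 i
  · exact congrFun hy0 i

variable {q j : ℕ}

/-- The vector `∑ᵣ (e_{c(r)} - e_{l(r)})` attached to a cycle, where `l(r)` is the lift of the edge
`c(r) → c(r+1)`; it lies in the left kernel of the matrix. -/
noncomputable def cycleVec (q : ℕ) (b e : ℕ → Fin k) : Fin k ⊕ Fin k → ℂ :=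
  ∑ r ∈ Finset.range q, (Pi.single (Sum.inl (b r)) 1 - Pi.single (Sum.inr (e r)) 1)

/-- The rows of `c(r)` and of the lift `l(r)` agree in their v-parts, and the differences of their
u-parts telescope around the cycle. -/
theorem cycleVec_mem_ker (hζ : ζ ^ k = 1) (hξ : ξ ^ (k + 1) = 1) {n : ℤ} {b e : ℕ → Fin k}
    (hb : b q = b 0)
    (h1 : ∀ r, ((b r : ℕ) : ℤ) = ((k : ℤ) + n + (e r : ℕ)) % (k + 1))
    (h2 : ∀ r, ((b (r + 1) : ℕ) : ℤ) = ((k : ℤ) + n + (e r : ℕ)) % k) :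
    cycleVec q b e ∈ LinearMap.ker (bigMatrix k ζ ξ n).transpose.mulVecLin := by
  rw [LinearMap.mem_ker, cycleVec, map_sum]
  have key : ∀ r, (bigMatrix k ζ ξ n).transpose.mulVecLin
      (Pi.single (Sum.inl (b r)) 1 - Pi.single (Sum.inr (e r)) 1) =
      Sum.elim (uRow k ζ ((b r : ℕ) : ℤ)) 0 - Sum.elim (uRow k ζ ((b (r + 1) : ℕ) : ℤ)) 0 := by
    intro r
    rw [map_sub, Matrix.mulVecLin_apply, Matrix.mulVecLin_apply, Matrix.mulVec_single_one,
      Matrix.mulVec_single_one]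
    change bigMatrix k ζ ξ n (Sum.inl (b r)) - bigMatrix k ζ ξ n (Sum.inr (e r)) = _
    rw [bigMatrix_inl, bigMatrix_inr, h2, uRow_emod hζ]
    ext (c | c)
    · simp [rowVec]
    · simp only [rowVec, Pi.sub_apply, Sum.elim_inr, Pi.zero_apply, sub_zero]
      rw [h1, vRow_emod hξ, sub_self]
  rw [Finset.sum_congr rfl fun r _ => key r, Finset.sum_range_sub', hb, sub_self]

/-- The coordinate at the starting vertex of a cycle sees that cycle only, since the cycles are
disjoint. -/
theorem linearIndependent_cycleVec {ι : Type*} [Fintype ι] {b e : ι → ℕ → Fin k} (hq : 1 ≤ q)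
    (hb : ∀ i i' r, r < q → b i' r = b i 0 → i' = i ∧ r = 0) :
    LinearIndependent ℂ fun i => cycleVec q (b i) (e i) := by
  classical
  rw [Fintype.linearIndependent_iff]
  intro g hg i
  have h := congrFun hg (Sum.inl (b i 0))
  rw [Finset.sum_apply] at h
  have hval : ∀ i', cycleVec q (b i') (e i') (Sum.inl (b i 0)) = if i' = i then 1 else 0 := by
    intro i'
    unfold cycleVec
    rw [Finset.sum_apply]
    have : ∀ r ∈ Finset.range q, ((Pi.single (Sum.inl (b i' r)) 1
        - Pi.single (Sum.inr (e i' r)) 1 : Fin k ⊕ Fin k → ℂ)) (Sum.inl (b i 0)) =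
        if i' = i ∧ r = 0 then 1 else 0 := by
      intro r hr
      rw [Finset.mem_range] at hr
      rw [Pi.sub_apply, Pi.single_apply, Pi.single_apply,
        if_neg (show ¬ (Sum.inl (b i 0) : Fin k ⊕ Fin k) = Sum.inr (e i' r) by simp), sub_zero]
      refine if_congr ⟨fun h => hb i i' r hr (by simpa using h.symm), ?_⟩ rfl rfl
      rintro ⟨rfl, rfl⟩
      rfl
    rw [Finset.sum_congr rfl this]
    by_cases hi : i' = i
    · simp only [hi, true_and, if_true]
      rw [Finset.sum_ite_eq' (Finset.range q) 0, if_pos (Finset.mem_range.2 hq)]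
    · simp [hi]
  simpa [hval] using h

theorem le_bandNullity_eta (hζ : ζ ^ k = 1) (hξ : ξ ^ (k + 1) = 1) (hq : 1 ≤ q)
    (hj : Nat.gcd j q = 1) : k / q ≤ bandNullity k ζ ξ (eta k q j) := by
  have hex : ∀ (w : Fin (k / q)) (r : ℕ), ∃ b e : Fin k,
      ((b : ℕ) : ℤ) = blockVertex k q j (r * j) ((w : ℕ) + 1) ∧
      ((b : ℕ) : ℤ) = ((k : ℤ) + eta k q j + (e : ℕ)) % (k + 1) ∧
      blockVertex k q j (((r + 1 : ℕ) : ℤ) * j) ((w : ℕ) + 1) =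
        ((k : ℤ) + eta k q j + (e : ℕ)) % k := by
    intro w r
    obtain ⟨l, h1, h2, h3, h4⟩ := linked_block (k := k) hq hj ((r : ℤ) * j)
      (w := ((w : ℕ) : ℤ) + 1) (by omega) (by omega)
    have h5 := blockVertex_nonneg (k := k) (j := j) hq ((r : ℤ) * j)
      (w := ((w : ℕ) : ℤ) + 1) (by omega)
    -- Cycle vertices avoid `k`, so each indexes one of the first `k` rows.
    have h6 := blockVertex_lt (k := k) (j := j) hq ((r : ℤ) * j)
      (w := ((w : ℕ) : ℤ) + 1) (by omega)
    refine ⟨⟨(blockVertex k q j (r * j) ((w : ℕ) + 1)).toNat, by omega⟩,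
      ⟨(l - k - eta k q j).toNat, by omega⟩, ?_⟩
    simp only [Int.toNat_of_nonneg h5, Int.toNat_of_nonneg (show 0 ≤ l - k - eta k q j by omega)]
    rw [show (k : ℤ) + eta k q j + (l - k - eta k q j) = l by ring]
    refine ⟨trivial, h3, ?_⟩
    rw [← h4]
    congr 1
    push_cast
    ring
  choose b e hb1 hb2 hb3 using hex
  have hmem : ∀ w, cycleVec q (b w) (e w) ∈
      LinearMap.ker (bigMatrix k ζ ξ (eta k q j)).transpose.mulVecLin := by
    intro w
    refine cycleVec_mem_ker hζ hξ ?_ (hb2 w) fun r => by rw [hb1, hb3]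
    apply Fin.ext
    zify
    rw [hb1, hb1]
    apply blockVertex_congr
    simp
  have hli : LinearIndependent ℂ fun w => cycleVec q (b w) (e w) := by
    refine linearIndependent_cycleVec hq fun w w' r hr h => ?_
    have h' : ((b w' r : ℕ) : ℤ) = ((b w 0 : ℕ) : ℤ) := by rw [h]
    rw [hb1, hb1] at h'
    rcases blockVertex_injective hq (by omega) (by omega) (by omega) (by omega) h' with h0 | ⟨h1, h2⟩
    · omega
    · refine ⟨Fin.ext (by omega), eq_of_dvd_mul_sub hj hr (by omega) h1⟩
  have hli' : LinearIndependent ℂ fun w => (⟨cycleVec q (b w) (e w), hmem w⟩ :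
      LinearMap.ker (bigMatrix k ζ ξ (eta k q j)).transpose.mulVecLin) :=
    LinearIndependent.of_comp (Submodule.subtype _) hli
  have := hli'.fintype_card_le_finrank
  rw [Fintype.card_fin] at this
  unfold bandNullity
  rwa [← nullity_transpose]

/-- A function on the lifted vertices that is constant along all cycle edges but those leaving one
block is constant on every cycle. -/
theorem block_const (hq : 1 ≤ q) (hj : Nat.gcd j q = 1) {g : ℤ → ℂ} {x₀ w : ℤ}
    (h : ∀ x, ¬ (q : ℤ) ∣ x - x₀ →
      g (blockVertex k q j x w) = g (blockVertex k q j (x + j) w)) (x : ℤ) :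
    g (blockVertex k q j x w) = g (blockVertex k q j (x₀ + j) w) := by
  obtain ⟨r, hr, hd⟩ := exists_dvd_sub_mul hq hj (x - (x₀ + j))
  have key : ∀ i : ℕ, i < q →
      g (blockVertex k q j (x₀ + j + i * j) w) = g (blockVertex k q j (x₀ + j) w) := by
    intro i
    induction i with
    | zero => simp
    | succ i ih =>
      intro hi
      rw [← ih (by omega), h (x₀ + j + i * j)]
      · congr 2
        push_cast
        ring
      · intro hdvd
        refine not_dvd_path hj (a := i + 1) (by omega) hi ?_
        have e : x₀ + j + i * j - x₀ = ((i + 1 : ℕ) : ℤ) * j := by push_cast; ring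
        rwa [e] at hdvd
  rw [← key r hr]
  congr 1
  apply blockVertex_congr
  rwa [sub_sub] at hd

theorem path_const (hq : 1 ≤ q) (hqk : q ≤ k) (hj : Nat.gcd j q = 1) {n : ℤ}
    (hn : |n - eta k q j| ≤ (k / q : ℕ)) {g : ℤ → ℂ} (hg : ∀ a b, Linked n k a b → g a = g b) :
    ∀ a : ℕ, a ≤ k % q → g (blockVertex k q j (a * j) 0) = g k := by
  intro a
  induction a with
  | zero =>
    intro _
    rw [Nat.cast_zero, zero_mul, blockVertex_self hq, sub_zero]
  | succ a ih =>
    intro ha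
    rw [← hg _ _ (linked_path hq hqk hj hn (show a < k % q by omega)), ih (by omega)]

/-- The path now runs into the opened cycle of index `k / q`, and the opened cycle `w + 1` into the
cycle `w`; the induction descends from `k / q`. -/
theorem bandNullity_eta_add (hζ : IsPrimitiveRoot ζ k) (hξ : IsPrimitiveRoot ξ (k + 1))
    (hq : 1 ≤ q) (hqk : q ≤ k) (hj : Nat.gcd j q = 1) :
    bandNullity k ζ ξ (eta k q j + (k / q : ℕ)) = 0 := by
  refine bandNullity_eq_zero_of_connected hζ hξ fun g hg v h0 hv => ?_
  have hpath := path_const hq hqk hj (n := eta k q j + (k / q : ℕ)) (by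
    rw [add_sub_cancel_left, abs_of_nonneg (by positivity)]) hg
  have hf : 1 ≤ k / q := Nat.div_pos hqk hq
  have hblock : ∀ w : ℤ, 1 ≤ w → w ≤ (k / q : ℕ) → ∀ x, g (blockVertex k q j x w) =
      g (blockVertex k q j (((k % q : ℕ) : ℤ) * j + 1 + j) w) := fun w h1 h2 =>
    block_const hq hj fun x hx => hg _ _ (linked_add_block hq hj hx h1 h2)
  have hall : ∀ i : ℕ, i < k / q → ∀ x, g (blockVertex k q j x ((k / q : ℕ) - i : ℤ)) = g k := by
    intro i
    induction i with
    | zero =>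
      intro _ x
      rw [Nat.cast_zero, sub_zero, hblock _ (by omega) le_rfl,
        ← hg _ _ (linked_add_path hq hqk hj), hpath _ le_rfl]
    | succ i ih =>
      intro hi x
      have := linked_add_succ (k := k) (j := j) hq (w := (k / q : ℕ) - (i + 1 : ℕ)) (by omega)
        (by omega)
      rw [hblock _ (by omega) (by omega), ← hg _ _ this, ← ih (by omega)]
      congr 2
      push_cast
      ring
  rcases exists_blockVertex_eq hq hj h0 hv with ⟨x, w, h1, h2, rfl⟩ | ⟨a, ha, rfl⟩
  · have := hall ((k / q : ℕ) - w).toNat (by omega) x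
    rwa [Int.toNat_of_nonneg (by omega), sub_sub_cancel] at this
  · exact hpath a ha

/-- The mirror image: the path runs into the opened cycle of index `1`, and the cycle `w` into the
cycle `w + 1`; the induction ascends from `1`. -/
theorem bandNullity_eta_sub (hζ : IsPrimitiveRoot ζ k) (hξ : IsPrimitiveRoot ξ (k + 1))
    (hq : 1 ≤ q) (hqk : q ≤ k) (hj : Nat.gcd j q = 1) :
    bandNullity k ζ ξ (eta k q j - (k / q : ℕ)) = 0 := by
  refine bandNullity_eq_zero_of_connected hζ hξ fun g hg v h0 hv => ?_
  have hpath := path_const hq hqk hj (n := eta k q j - (k / q : ℕ)) (by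
    rw [sub_sub_cancel_left, abs_neg, abs_of_nonneg (by positivity)]) hg
  have hblock : ∀ w : ℤ, 1 ≤ w → w ≤ (k / q : ℕ) → ∀ x, g (blockVertex k q j x w) =
      g (blockVertex k q j (((k % q : ℕ) : ℤ) * j + j) w) := fun w h1 h2 =>
    block_const hq hj fun x hx => hg _ _ (linked_sub_block hq hj hx h1 h2)
  have hall : ∀ i : ℕ, i < k / q → ∀ x, g (blockVertex k q j x (i + 1 : ℤ)) = g k := by
    intro i
    induction i with
    | zero =>
      intro hf x
      have := linked_sub_succ (k := k) (j := j) hq hj (w := 1) le_rfl (by omega)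
      rw [Nat.cast_zero, zero_add, hblock _ le_rfl (by omega), ← hg _ _ this, sub_self,
        hpath _ le_rfl]
    | succ i ih =>
      intro hi x
      have := linked_sub_succ (k := k) (j := j) hq hj (w := (i + 1 : ℕ) + 1) (by omega)
        (by omega)
      rw [hblock _ (by omega) (by omega), ← hg _ _ this, add_sub_cancel_right]
      exact_mod_cast ih (by omega) _
  rcases exists_blockVertex_eq hq hj h0 hv with ⟨x, w, h1, h2, rfl⟩ | ⟨a, ha, rfl⟩
  · have := hall (w - 1).toNat (by omega) x
    rwa [Int.toNat_of_nonneg (by omega), sub_add_cancel] at this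
  · exact hpath a ha

/-- Around `η(q,j)` the nullity is given by a triangle of height `⌊k/q⌋`. -/
theorem bandNullity_eq_sub_abs (hζ : IsPrimitiveRoot ζ k) (hξ : IsPrimitiveRoot ξ (k + 1))
    (hq : 1 ≤ q) (hqk : q ≤ k) (hj : Nat.gcd j q = 1) {n : ℤ}
    (hn : |n - eta k q j| ≤ (k / q : ℕ)) :
    (bandNullity k ζ ξ n : ℤ) = (k / q : ℕ) - |n - eta k q j| := by
  have h1 := le_bandNullity_eta hζ.pow_eq_one hξ.pow_eq_one (k := k) hq hj
  have h2 := bandNullity_le_add_abs (k := k) (ζ := ζ) (ξ := ξ) (eta k q j) n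
  rw [abs_sub_comm] at h2
  -- The zero at `η ± k / q` on the side of `n` bounds from above, and the value at `η` from below,
  -- both by the Lipschitz property.
  apply le_antisymm
  · rcases abs_cases (n - eta k q j) with ⟨h, h'⟩ | ⟨h, h'⟩
    · have h3 := bandNullity_le_add_abs (k := k) (ζ := ζ) (ξ := ξ) n (eta k q j + (k / q : ℕ))
      rw [bandNullity_eta_add hζ hξ hq hqk hj, abs_of_nonpos (by omega)] at h3
      push_cast at h3 hn ⊢
      omega
    · have h3 := bandNullity_le_add_abs (k := k) (ζ := ζ) (ξ := ξ) n (eta k q j - (k / q : ℕ))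
      rw [bandNullity_eta_sub hζ hξ hq hqk hj, abs_of_nonneg (by omega)] at h3
      push_cast at h3 hn ⊢
      omega
  · omega

end nullity

/-! ### The band matrix and its generating polynomial -/

section band

open Polynomial

theorem mulVec_map_ofReal {ι : Type*} [Fintype ι] (M : Matrix ι ι ℝ) (z : ι → ℂ) (i : ι) :
    ((M.map Complex.ofReal).mulVec z i).re = M.mulVec (fun b => (z b).re) i ∧
      ((M.map Complex.ofReal).mulVec z i).im = M.mulVec (fun b => (z b).im) i := by
  simp [Matrix.mulVec, dotProduct, Complex.re_sum, Complex.im_sum]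

theorem mem_ker_map_ofReal {ι : Type*} [Fintype ι] (M : Matrix ι ι ℝ) (z : ι → ℂ) :
    z ∈ LinearMap.ker (M.map Complex.ofReal).mulVecLin ↔
      (fun b => (z b).re) ∈ LinearMap.ker M.mulVecLin ∧
        (fun b => (z b).im) ∈ LinearMap.ker M.mulVecLin := by
  simp only [LinearMap.mem_ker, Matrix.mulVecLin_apply]
  constructor
  · intro h
    refine ⟨funext fun i => ?_, funext fun i => ?_⟩
    · rw [← (mulVec_map_ofReal M z i).1, h]; rfl
    · rw [← (mulVec_map_ofReal M z i).2, h]; rfl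
  · rintro ⟨h1, h2⟩
    ext i
    refine Complex.ext ?_ ?_
    · rw [(mulVec_map_ofReal M z i).1, h1]; rfl
    · rw [(mulVec_map_ofReal M z i).2, h2]; rfl

/-- The complex kernel of a real matrix is the complexification of the real kernel. -/
noncomputable def kerMapOfRealEquiv {ι : Type*} [Fintype ι] (M : Matrix ι ι ℝ) :
    LinearMap.ker (M.map Complex.ofReal).mulVecLin ≃ₗ[ℝ]
      LinearMap.ker M.mulVecLin × LinearMap.ker M.mulVecLin where
  toFun z := (⟨_, ((mem_ker_map_ofReal M z.1).1 z.2).1⟩, ⟨_, ((mem_ker_map_ofReal M z.1).1 z.2).2⟩)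
  invFun p := ⟨fun b => ⟨p.1.1 b, p.2.1 b⟩, (mem_ker_map_ofReal M _).2 ⟨p.1.2, p.2.2⟩⟩
  left_inv z := rfl
  right_inv p := rfl
  map_add' y z := rfl
  map_smul' c z := by
    refine Prod.ext (Subtype.ext (funext fun b => ?_)) (Subtype.ext (funext fun b => ?_))
    · simp
    · simp

/-- Compare real dimensions: the complex kernel has twice its complex dimension, and it is two
copies of the real kernel. -/
theorem nullity_map_ofReal {ι : Type*} [Fintype ι] (M : Matrix ι ι ℝ) :
    nullity (M.map Complex.ofReal) = nullity M := by
  have h1 := (kerMapOfRealEquiv M).finrank_eq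
  rw [Module.finrank_prod, finrank_real_of_complex] at h1
  unfold nullity
  omega

variable {k : ℕ} {ζ ξ : ℂ}

/-- The polynomial `(X ^ (k + 1) - 1) (1 + X + ⋯ + X ^ (k - 1))`. -/
noncomputable def bandPoly (k : ℕ) : ℂ[X] :=
  (X ^ (k + 1) - 1) * ∑ i ∈ Finset.range k, X ^ i

theorem coeff_geom (m : ℕ) :
    (∑ i ∈ Finset.range k, (X : ℂ[X]) ^ i).coeff m = if m < k then 1 else 0 := by
  simp [Polynomial.coeff_X_pow]

theorem coeff_bandPoly (m : ℕ) : (bandPoly k).coeff m =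
    (if k + 1 ≤ m ∧ m < 2 * k + 1 then 1 else 0) - if m < k then 1 else 0 := by
  unfold bandPoly
  rw [sub_mul, one_mul, Polynomial.coeff_sub, Polynomial.coeff_X_pow_mul', coeff_geom, coeff_geom]
  congr 1
  by_cases h : k + 1 ≤ m
  · rw [if_pos h]
    exact if_congr (by omega) rfl rfl
  · rw [if_neg h, if_neg (by omega)]

theorem monic_bandPoly (hk : 1 ≤ k) : (bandPoly k).Monic :=
  (monic_X_pow_sub_C 1 (Nat.succ_ne_zero k)).mul (monic_geom_sum_X (by omega))

theorem natDegree_bandPoly (hk : 1 ≤ k) : (bandPoly k).natDegree = 2 * k := by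
  apply natDegree_eq_of_le_of_coeff_ne_zero
  · rw [natDegree_le_iff_coeff_eq_zero]
    intro m hm
    rw [coeff_bandPoly, if_neg (by omega), if_neg (by omega), sub_zero]
  · rw [coeff_bandPoly, if_pos (by omega), if_neg (by omega)]
    simp

/-- The roots of `bandPoly k`. -/
noncomputable def bandRoot (k : ℕ) (ζ ξ : ℂ) : Fin k ⊕ Fin k → ℂ :=
  Sum.elim (fun c => ζ ^ (c : ℕ)) (fun c => ξ ^ ((c : ℕ) + 1))

/-- A number that is both a `k`-th and a `(k + 1)`-th root of unity is `1`, which is not among the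
powers of `ξ` used. -/
theorem bandRoot_injective (hζ : IsPrimitiveRoot ζ k) (hξ : IsPrimitiveRoot ξ (k + 1)) :
    Function.Injective (bandRoot k ζ ξ) := by
  have hne : ∀ c d : Fin k, ζ ^ (c : ℕ) ≠ ξ ^ ((d : ℕ) + 1) := by
    intro c d h
    have h1 : (ζ ^ (c : ℕ)) ^ k = 1 := by
      rw [← pow_mul, mul_comm, pow_mul, hζ.pow_eq_one, one_pow]
    have h2 : (ξ ^ ((d : ℕ) + 1)) ^ (k + 1) = 1 := by
      rw [← pow_mul, mul_comm, pow_mul, hξ.pow_eq_one, one_pow]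
    rw [← h, pow_succ, h1, one_mul, h] at h2
    exact hξ.pow_ne_one_of_pos_of_lt (by omega) (by omega) h2
  rintro (c | c) (d | d) h
  · exact congrArg _ (injective_pow_fin hζ le_rfl h)
  · exact absurd h (hne c d)
  · exact absurd h.symm (hne d c)
  · have := hξ.pow_inj (by omega) (by omega) h
    exact congrArg _ (Fin.ext (by omega))

theorem eval_bandPoly_bandRoot (hζ : IsPrimitiveRoot ζ k) (hξ : IsPrimitiveRoot ξ (k + 1))
    (c : Fin k ⊕ Fin k) : (bandPoly k).eval (bandRoot k ζ ξ c) = 0 := by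
  unfold bandPoly
  rw [eval_mul, eval_sub, eval_pow, eval_X, eval_one, eval_geom_sum]
  rcases c with c | c
  · by_cases hc : (c : ℕ) = 0
    · simp [bandRoot, hc]
    · refine mul_eq_zero_of_right _ ?_
      have h1 : ζ ^ (c : ℕ) ≠ 1 := hζ.pow_ne_one_of_pos_of_lt hc c.2
      have h2 := mul_geom_sum (ζ ^ (c : ℕ)) k
      rw [← pow_mul, mul_comm _ k, pow_mul ζ k, hζ.pow_eq_one, one_pow, sub_self] at h2
      exact (mul_eq_zero.1 h2).resolve_left (sub_ne_zero.2 h1)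
  · refine mul_eq_zero_of_left ?_ _
    simp only [bandRoot, Sum.elim_inr]
    rw [← pow_mul, mul_comm _ (k + 1), pow_mul ξ (k + 1), hξ.pow_eq_one, one_pow, sub_self]

/-- The remainder has degree below `2 k` and `2 k` distinct zeros. -/
theorem bandPoly_dvd (hk : 1 ≤ k) (hζ : IsPrimitiveRoot ζ k) (hξ : IsPrimitiveRoot ξ (k + 1))
    {P : ℂ[X]} (h : ∀ c, P.eval (bandRoot k ζ ξ c) = 0) : bandPoly k ∣ P := by
  rw [← modByMonic_eq_zero_iff_dvd (monic_bandPoly hk)]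
  refine Polynomial.eq_zero_of_natDegree_lt_card_of_eval_eq_zero _
    (bandRoot_injective hζ hξ) (fun c => ?_) ?_
  · have := congrArg (eval (bandRoot k ζ ξ c)) (modByMonic_add_div P (bandPoly k))
    rwa [eval_add, eval_mul, eval_bandPoly_bandRoot hζ hξ, zero_mul, add_zero, h] at this
  · have := natDegree_modByMonic_lt P (monic_bandPoly hk) (by
      intro h1
      have := natDegree_bandPoly hk
      rw [h1, natDegree_one] at this
      omega)
    rw [natDegree_bandPoly hk] at this
    simp only [Fintype.card_sum, Fintype.card_fin]
    omega

theorem eval_ofFn {n : ℕ} (v : Fin n → ℂ) (ρ : ℂ) :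
    (ofFn n v).eval ρ = ∑ i : Fin n, v i * ρ ^ (i : ℕ) := by
  rw [ofFn_eq_sum_monomial, eval_finsetSum]
  simp only [eval_monomial]

theorem coeff_mul_ofFn {n : ℕ} (p : ℂ[X]) (v : Fin n → ℂ) (m : ℕ) :
    (p * ofFn n v).coeff m =
      ∑ b : Fin n, if (b : ℕ) ≤ m then p.coeff (m - b) * v b else 0 := by
  rw [ofFn_eq_sum_monomial, Finset.mul_sum, finsetSum_coeff]
  refine Finset.sum_congr rfl fun b _ => ?_
  rw [← C_mul_X_pow_eq_monomial, ← mul_assoc, coeff_mul_X_pow', coeff_mul_C]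

/-- The middle coefficients of `bandPoly k * X(z)` are the entries of `-A(n,k) X`. -/
theorem coeff_bandPoly_mul (n : ℕ) (v : Fin n → ℂ) (a : Fin n) :
    (bandPoly k * ofFn n v).coeff (a + k) =
      -((bandMatrix n k).map Complex.ofReal).mulVec v a := by
  rw [coeff_mul_ofFn, Matrix.mulVec, dotProduct, ← Finset.sum_neg_distrib]
  refine Finset.sum_congr rfl fun b _ => ?_
  rw [Matrix.map_apply, bandMatrix]
  by_cases hb : (b : ℕ) ≤ a + k
  · rw [if_pos hb, coeff_bandPoly]
    by_cases h1 : (a : ℕ) < b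
    · rw [if_neg (by omega), if_pos (by omega), if_pos ⟨h1, hb⟩]
      simp
    · rw [if_neg (show ¬ (a : ℕ) + k - b < k by omega),
        if_neg (show ¬ ((a : ℕ) < b ∧ (b : ℕ) ≤ a + k) from fun h => h1 h.1)]
      by_cases h2 : (b : ℕ) < a ∧ (a : ℕ) ≤ b + k
      · rw [if_pos (by omega), if_pos h2]
        simp
      · rw [if_neg (by omega), if_neg h2]
        simp
  · rw [if_neg hb, if_neg (by omega), if_neg (by omega)]
    simp

/-- The polynomial with low coefficients `z ∘ inl` and coefficients `z ∘ inr` from `n + k` on. -/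
noncomputable def outerPoly (n k : ℕ) (z : Fin k ⊕ Fin k → ℂ) : ℂ[X] :=
  ofFn k (z ∘ Sum.inl) + X ^ (n + k) * ofFn k (z ∘ Sum.inr)

/-- The transposed matrix evaluates `outerPoly` at the roots of `bandPoly`. -/
theorem mulVec_transpose_bigMatrix (n : ℕ) (z : Fin k ⊕ Fin k → ℂ) (c : Fin k ⊕ Fin k) :
    (bigMatrix k ζ ξ n).transpose.mulVec z c = (outerPoly n k z).eval (bandRoot k ζ ξ c) := by
  unfold outerPoly
  rw [eval_add, eval_mul, eval_pow, eval_X, eval_ofFn, eval_ofFn, Matrix.mulVec, dotProduct,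
    Fintype.sum_sum_type, Finset.mul_sum]
  simp only [Matrix.transpose_apply, bigMatrix_inl, bigMatrix_inr, rowVec]
  rcases c with c | c
  · congr 1
    · refine Finset.sum_congr rfl fun i _ => ?_
      simp only [Sum.elim_inl, uRow, bandRoot, Function.comp_apply]
      rw [mul_comm, ← pow_mul]
      norm_cast
    · refine Finset.sum_congr rfl fun i _ => ?_
      simp only [Sum.elim_inl, uRow, bandRoot, Function.comp_apply]
      rw [mul_comm (ζ ^ _), mul_left_comm, ← pow_add, ← pow_mul, add_comm n k]
      norm_cast
  · congr 1
    · refine Finset.sum_congr rfl fun i _ => ?_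
      simp only [Sum.elim_inr, vRow, bandRoot, Function.comp_apply]
      rw [mul_comm, ← pow_mul]
      norm_cast
    · refine Finset.sum_congr rfl fun i _ => ?_
      simp only [Sum.elim_inr, vRow, bandRoot, Function.comp_apply]
      rw [mul_comm (ξ ^ _), mul_left_comm, ← pow_add, ← pow_mul, add_comm n k]
      norm_cast

/-- The outer coefficients of `bandPoly k * X(z)`. -/
noncomputable def outerCoeffs (n k : ℕ) : (Fin n → ℂ) →ₗ[ℂ] (Fin k ⊕ Fin k → ℂ) :=
  LinearMap.pi (Sum.elim (fun i => lcoeff ℂ (i : ℕ)) (fun i => lcoeff ℂ (n + k + i))) ∘ₗ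
    LinearMap.mulLeft ℂ (bandPoly k) ∘ₗ ofFn n

theorem outerCoeffs_inl (n : ℕ) (v : Fin n → ℂ) (i : Fin k) :
    outerCoeffs n k v (Sum.inl i) = (bandPoly k * ofFn n v).coeff i := rfl

theorem outerCoeffs_inr (n : ℕ) (v : Fin n → ℂ) (i : Fin k) :
    outerCoeffs n k v (Sum.inr i) = (bandPoly k * ofFn n v).coeff (n + k + i) := rfl

theorem coeff_outerPoly (n : ℕ) (z : Fin k ⊕ Fin k → ℂ) (m : ℕ) :
    (outerPoly n k z).coeff m = (ofFn k (z ∘ Sum.inl)).coeff m +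
      if n + k ≤ m then (ofFn k (z ∘ Sum.inr)).coeff (m - (n + k)) else 0 := by
  rw [outerPoly, coeff_add, coeff_X_pow_mul']

theorem coeff_outerPoly_middle (n : ℕ) (z : Fin k ⊕ Fin k → ℂ) (a : Fin n) :
    (outerPoly n k z).coeff (a + k) = 0 := by
  rw [coeff_outerPoly, ofFn_coeff_eq_zero_of_ge _ (by omega), if_neg (by omega), add_zero]

/-- The kernel condition kills the coefficients from `k` to `n + k - 1`, and those from `n + 2 k` on
vanish by degree. -/
theorem bandPoly_mul_eq_outerPoly (n : ℕ) {v : Fin n → ℂ}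
    (hv : v ∈ LinearMap.ker ((bandMatrix n k).map Complex.ofReal).mulVecLin) :
    bandPoly k * ofFn n v = outerPoly n k (outerCoeffs n k v) := by
  rw [LinearMap.mem_ker, Matrix.mulVecLin_apply] at hv
  ext m
  rcases lt_or_ge m k with h1 | h1
  · rw [coeff_outerPoly, ofFn_coeff_eq_val_of_lt _ h1, if_neg (by omega), add_zero]
    rfl
  · rcases lt_or_ge m (n + k) with h2 | h2
    · obtain ⟨a, rfl⟩ := Nat.exists_eq_add_of_le' h1
      have := coeff_bandPoly_mul (k := k) n v ⟨a, by omega⟩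
      rw [hv] at this
      simp only [Pi.zero_apply, neg_zero] at this
      rw [this]
      exact (coeff_outerPoly_middle n _ ⟨a, by omega⟩).symm
    · rw [coeff_outerPoly, ofFn_coeff_eq_zero_of_ge _ h1, if_pos h2, zero_add]
      rcases lt_or_ge m (n + k + k) with h3 | h3
      · rw [ofFn_coeff_eq_val_of_lt _ (show m - (n + k) < k by omega), Function.comp_apply,
          outerCoeffs_inr]
        congr 1
        simp only
        omega
      · rw [ofFn_coeff_eq_zero_of_ge _ (by omega), coeff_mul_ofFn]
        refine Finset.sum_eq_zero fun b _ => ?_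
        rw [coeff_bandPoly, if_neg (show ¬ (k + 1 ≤ m - b ∧ m - b < 2 * k + 1) by omega),
          if_neg (show ¬ (m - b < k) by omega)]
        simp

theorem outerCoeffs_mem_ker (hζ : IsPrimitiveRoot ζ k) (hξ : IsPrimitiveRoot ξ (k + 1)) (n : ℕ)
    {v : Fin n → ℂ} (hv : v ∈ LinearMap.ker ((bandMatrix n k).map Complex.ofReal).mulVecLin) :
    outerCoeffs n k v ∈ LinearMap.ker (bigMatrix k ζ ξ n).transpose.mulVecLin := by
  rw [LinearMap.mem_ker, Matrix.mulVecLin_apply]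
  ext c
  rw [mulVec_transpose_bigMatrix, ← bandPoly_mul_eq_outerPoly n hv, eval_mul,
    eval_bandPoly_bandRoot hζ hξ, zero_mul]
  rfl

/-- A left kernel vector makes `outerPoly` vanish at every root of `bandPoly`. The quotient has
degree below `n`, and its coefficients form the required vector. -/
theorem exists_outerCoeffs_eq (hk : 1 ≤ k) (hζ : IsPrimitiveRoot ζ k)
    (hξ : IsPrimitiveRoot ξ (k + 1)) {n : ℕ} (hn : 1 ≤ n) {z : Fin k ⊕ Fin k → ℂ}
    (hz : z ∈ LinearMap.ker (bigMatrix k ζ ξ n).transpose.mulVecLin) :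
    ∃ v ∈ LinearMap.ker ((bandMatrix n k).map Complex.ofReal).mulVecLin,
      outerCoeffs n k v = z := by
  rw [LinearMap.mem_ker, Matrix.mulVecLin_apply] at hz
  obtain ⟨p, hp⟩ := bandPoly_dvd hk hζ hξ (P := outerPoly n k z) fun c => by
    rw [← mulVec_transpose_bigMatrix, hz]; rfl
  have hdeg : p.natDegree < n := by
    by_cases hp0 : p = 0
    · rw [hp0, natDegree_zero]; omega
    have h1 : (outerPoly n k z).natDegree ≤ n + 2 * k - 1 := by
      rw [natDegree_le_iff_coeff_eq_zero]
      intro m hm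
      rw [coeff_outerPoly, ofFn_coeff_eq_zero_of_ge _ (by omega), if_pos (by omega),
        ofFn_coeff_eq_zero_of_ge _ (by omega), add_zero]
    rw [hp, (monic_bandPoly hk).natDegree_mul' hp0, natDegree_bandPoly hk] at h1
    omega
  rw [← ofFn_comp_toFn_eq_id_of_natDegree_lt hdeg] at hp
  refine ⟨toFn n p, ?_, ?_⟩
  · rw [LinearMap.mem_ker, Matrix.mulVecLin_apply]
    ext a
    rw [← neg_eq_zero.trans (by rfl : _ ↔ ((bandMatrix n k).map Complex.ofReal).mulVec (toFn n p) a
      = (0 : Fin n → ℂ) a), ← coeff_bandPoly_mul, ← hp, coeff_outerPoly_middle]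
  · ext (i | i)
    · rw [outerCoeffs_inl, ← hp, coeff_outerPoly, ofFn_coeff_eq_val_of_lt _ i.2,
        if_neg (by omega), add_zero]
      rfl
    · rw [outerCoeffs_inr, ← hp, coeff_outerPoly, ofFn_coeff_eq_zero_of_ge _ (by omega),
        if_pos (by omega), zero_add, Nat.add_sub_cancel_left, ofFn_coeff_eq_val_of_lt _ i.2]
      rfl

/-- The nullity of the band matrix `A(n,k)` is `N(n,k)`. -/
theorem nullity_bandMatrix (hk : 1 ≤ k) (hζ : IsPrimitiveRoot ζ k)
    (hξ : IsPrimitiveRoot ξ (k + 1)) {n : ℕ} (hn : 1 ≤ n) :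
    nullity (bandMatrix n k) = bandNullity k ζ ξ n := by
  rw [← nullity_map_ofReal, bandNullity, ← nullity_transpose (bigMatrix k ζ ξ n)]
  let Φ : LinearMap.ker ((bandMatrix n k).map Complex.ofReal).mulVecLin →ₗ[ℂ]
      LinearMap.ker (bigMatrix k ζ ξ n).transpose.mulVecLin :=
    (outerCoeffs n k).restrict fun v hv => outerCoeffs_mem_ker hζ hξ n hv
  have hinj : Function.Injective Φ := by
    rw [← LinearMap.ker_eq_bot, eq_bot_iff]
    rintro ⟨v, hv⟩ h
    have h0 : outerCoeffs n k v = 0 := congrArg Subtype.val h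
    have h1 := bandPoly_mul_eq_outerPoly n hv
    rw [h0] at h1
    have h2 : outerPoly n k (0 : Fin k ⊕ Fin k → ℂ) = 0 := by
      simp [outerPoly, Pi.zero_comp]
    rw [h2] at h1
    have h3 := (mul_eq_zero.1 h1).resolve_left (monic_bandPoly hk).ne_zero
    rw [Submodule.mem_bot]
    exact Subtype.ext (injective_ofFn n (h3.trans (map_zero _).symm))
  have hsurj : Function.Surjective Φ := by
    rintro ⟨z, hz⟩
    obtain ⟨v, hv, h⟩ := exists_outerCoeffs_eq hk hζ hξ hn hz
    exact ⟨⟨v, hv⟩, Subtype.ext h⟩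
  exact (LinearEquiv.ofBijective Φ ⟨hinj, hsurj⟩).finrank_eq

end band

/-! ### The triangles tile `[0, k² + k]` -/

section tiling

variable {k q j : ℕ}

theorem sCount_le : sCount k q j ≤ k % q := by
  unfold sCount
  refine (Finset.card_filter_le _ _).trans ?_
  simp

/-- `η(q,j)` lies in the interval of length `k - ⌊k/q⌋` above `k ⌊(k+1)j/q⌋ - k`. -/
theorem eta_le (hq : 1 ≤ q) :
    eta k q j ≤ k * ((k + 1) * j / q : ℕ) - (k / q : ℕ) := by
  have h1 := Nat.mod_lt ((k % q + 1) * j) hq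
  have h2 := sCount_le (k := k) (q := q) (j := j)
  have h3 : ((k % q + 1) * j % q) * (k / q) ≤ (q - 1) * (k / q) := Nat.mul_le_mul_right _ (by omega)
  have h4 := Nat.div_add_mod k q
  have h5 : (q - 1) * (k / q) + k / q = q * (k / q) := by
    rw [← Nat.succ_mul]
    congr 1
    omega
  unfold eta
  zify at h2 h3 h4 h5
  push_cast at h2 h3 h4 h5 ⊢
  linarith

theorem le_eta : (k : ℤ) * ((k + 1) * j / q : ℕ) - k ≤ eta k q j := by
  unfold eta
  have : (0 : ℤ) ≤ (((k % q + 1) * j % q : ℕ) : ℤ) * (k / q : ℕ) := by positivity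
  omega

/-- If the quotient `⌊(k + 1) j / q⌋` is at least `2`, then `η ≥ k`. Otherwise `(k + 1) j < 2 q ≤ 2
k` forces `j = 1` and `k / q = 1`, and `η ≥ 1` is read off the formula. -/
theorem div_le_eta (hq : 1 ≤ q) (hqk : q ≤ k) (hj : 1 ≤ j) : ((k / q : ℕ) : ℤ) ≤ eta k q j := by
  have hfk : k / q ≤ k := Nat.div_le_self k q
  rcases lt_or_ge ((k + 1) * j / q) 2 with h | h
  · rw [Nat.div_lt_iff_lt_mul hq] at h
    obtain rfl : j = 1 := by
      by_contra hne
      have : 2 ≤ j := by omega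
      nlinarith
    have hf : k / q = 1 := Nat.div_eq_of_lt_le (by omega) (by omega)
    have hm := Nat.div_add_mod k q
    rw [hf] at hm
    have hR : (k % q + 1) * 1 % q = k % q + 1 := by
      rw [mul_one]
      exact Nat.mod_eq_of_lt (by omega)
    have hF : (k + 1) * 1 / q = 1 := Nat.div_eq_of_lt_le (by omega) (by omega)
    unfold eta
    rw [hF, hR, hf]
    push_cast
    omega
  · have h1 := le_eta (k := k) (q := q) (j := j)
    have h2 : (k : ℤ) * 2 ≤ k * ((k + 1) * j / q : ℕ) :=
      mul_le_mul_of_nonneg_left (by exact_mod_cast h) (by positivity)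
    omega

theorem eta_le_sub (hq : 1 ≤ q) (hjq : j ≤ q) :
    eta k q j ≤ (k : ℤ) ^ 2 + k - (k / q : ℕ) := by
  have h1 := eta_le (k := k) (j := j) hq
  have h2 : (k + 1) * j / q ≤ k + 1 :=
    Nat.div_le_of_le_mul (by rw [mul_comm q]; exact Nat.mul_le_mul_left _ hjq)
  have h3 : (k : ℤ) * ((k + 1) * j / q : ℕ) ≤ k * (k + 1) :=
    mul_le_mul_of_nonneg_left (by exact_mod_cast h2) (by positivity)
  linarith

/-- Since `k + 1 ≥ q`, the quotient `⌊(k + 1) j / q⌋` strictly increases with `j`, and `le_eta` and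
`eta_le` place `η` in disjoint intervals for different quotients. -/
theorem eta_lt_eta (hq : 1 ≤ q) (hqk : q ≤ k) {j' : ℕ} (h : j < j') :
    eta k q j < eta k q j' := by
  have h1 := eta_le (k := k) (j := j) hq
  have h2 := le_eta (k := k) (q := q) (j := j')
  have hf : (1 : ℤ) ≤ (k / q : ℕ) := by exact_mod_cast Nat.div_pos hqk hq
  have h3 : (k + 1) * j / q + 1 ≤ (k + 1) * j' / q := by
    rw [← Nat.add_div_right _ hq]
    exact Nat.div_le_div_right (by nlinarith)
  have h4 : (k : ℤ) * (((k + 1) * j / q : ℕ) + 1) ≤ k * ((k + 1) * j' / q : ℕ) :=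
    mul_le_mul_of_nonneg_left (by exact_mod_cast h3) (by positivity)
  linarith

/-- `η` determines the graph, and the graph determines `q` as the length of its cycles, of which
there is at least one. For fixed `q`, monotonicity in `j` finishes. -/
theorem injOn_eta : Set.InjOn (fun p : ℕ × ℕ => eta k p.1 p.2) (admissible k) := by
  rintro ⟨q, j⟩ ⟨hq, hqk, -, -, hj⟩ ⟨q', j'⟩ ⟨hq', hqk', -, -, hj'⟩ h
  simp only at hq hqk hj hq' hqk' hj' h
  have hmem := blockCycle_mem_cycles (k := k) hq hj le_rfl (Nat.div_pos hqk hq)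
  have h1 := length_of_mem_cycles_bandGraph_eta hq hqk hj hmem
  rw [h] at hmem
  obtain rfl : q = q' := h1.symm.trans (length_of_mem_cycles_bandGraph_eta hq' hqk' hj' hmem)
  rcases lt_trichotomy j j' with hlt | rfl | hgt
  · exact absurd h (eta_lt_eta hq hqk hlt).ne
  · rfl
  · exact absurd h (eta_lt_eta hq hqk hgt).ne'

/-- Raising `k` to `k + 1` increases the quotient by one exactly at the divisors of `k + 1`, whose
totients sum to `k + 1`. -/
theorem two_mul_sum_totient_mul_div (k : ℕ) :
    2 * ∑ q ∈ Finset.Icc 1 k, q.totient * (k / q) = k * (k + 1) := by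
  induction k with
  | zero => simp
  | succ k ih =>
    have h1 : ∑ q ∈ Finset.Icc 1 (k + 1), q.totient * ((k + 1) / q) =
        ∑ q ∈ Finset.Icc 1 k, q.totient * (k / q) + (k + 1) := by
      simp only [Nat.succ_div, mul_add, Finset.sum_add_distrib, mul_ite, mul_one, mul_zero]
      congr 1
      · rw [Finset.sum_Icc_succ_top (by omega), Nat.div_eq_of_lt (Nat.lt_succ_self k), mul_zero,
          add_zero]
      · rw [← Finset.sum_filter]
        conv_rhs => rw [← Nat.sum_totient (k + 1)]
        rfl
    rw [h1, mul_add, ih]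
    ring

variable {ζ ξ : ℂ}

/-- The peak intervals of two triangles of a function do not overlap. -/
theorem triangle_disjoint {N : ℤ → ℤ} {a b f g : ℤ} (hg : 1 ≤ g) (hab : a < b)
    (ha : ∀ n, |n - a| ≤ f → N n = f - |n - a|) (hb : ∀ n, |n - b| ≤ g → N n = g - |n - b|)
    (hf : 1 ≤ f) : a + f ≤ b - g := by
  by_contra hc
  push Not at hc
  -- If `a + f < b`, the first triangle is zero at `a + f` while the second is positive there.
  -- Otherwise, around `b`, the first triangle descends from `b - 1` to `b` while the second
  -- ascends.
  rcases lt_or_ge (a + f) b with h | h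
  · have h1 := ha (a + f) (by rw [abs_of_nonneg] <;> omega)
    have h2 := hb (a + f) (by rw [abs_of_nonpos] <;> omega)
    rw [abs_of_nonneg (by omega)] at h1
    rw [abs_of_nonpos (by omega)] at h2
    omega
  · have h1 := ha b (by rw [abs_of_nonneg] <;> omega)
    have h2 := hb b (by rw [abs_of_nonneg] <;> omega)
    have h3 := ha (b - 1) (by rw [abs_of_nonneg] <;> omega)
    have h4 := hb (b - 1) (by rw [abs_of_nonpos] <;> omega)
    rw [abs_of_nonneg (by omega)] at h1 h2 h3
    rw [abs_of_nonpos (by omega)] at h4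
    omega

theorem eq_of_mem_peak_intervals (hζ : IsPrimitiveRoot ζ k) (hξ : IsPrimitiveRoot ξ (k + 1))
    {p p' : ℕ × ℕ} (hp : p ∈ admissible k) (hp' : p' ∈ admissible k) {n : ℤ}
    (h1 : eta k p.1 p.2 - ((k / p.1 : ℕ) : ℤ) ≤ n) (h2 : n < eta k p.1 p.2 + ((k / p.1 : ℕ) : ℤ))
    (h1' : eta k p'.1 p'.2 - ((k / p'.1 : ℕ) : ℤ) ≤ n)
    (h2' : n < eta k p'.1 p'.2 + ((k / p'.1 : ℕ) : ℤ)) : p = p' := by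
  by_contra hne
  obtain ⟨hq, hqk, -, -, hj⟩ := id hp
  obtain ⟨hq', hqk', -, -, hj'⟩ := id hp'
  have hf : 1 ≤ k / p.1 := Nat.div_pos hqk hq
  have hf' : 1 ≤ k / p'.1 := Nat.div_pos hqk' hq'
  have hN := fun n => bandNullity_eq_sub_abs (n := n) hζ hξ hq hqk hj
  have hN' := fun n => bandNullity_eq_sub_abs (n := n) hζ hξ hq' hqk' hj'
  have hne' : eta k p.1 p.2 ≠ eta k p'.1 p'.2 := fun h => hne (injOn_eta hp hp' h)
  rcases lt_or_gt_of_ne hne' with h | h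
  · have := triangle_disjoint (by omega) h hN hN' (by omega)
    omega
  · have := triangle_disjoint (by omega) h hN' hN (by omega)
    omega

/-- The intervals `[η(q,j) - ⌊k/q⌋, η(q,j) + ⌊k/q⌋)` cover `[0, k² + k)`. -/
theorem exists_peak_interval (hζ : IsPrimitiveRoot ζ k) (hξ : IsPrimitiveRoot ξ (k + 1))
    {n : ℤ} (h0 : 0 ≤ n) (hn : n < (k : ℤ) ^ 2 + k) :
    ∃ p ∈ admissible k, eta k p.1 p.2 - ((k / p.1 : ℕ) : ℤ) ≤ n ∧
      n < eta k p.1 p.2 + ((k / p.1 : ℕ) : ℤ) := by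
  let S : Finset (Σ _ : ℕ, ℕ) :=
    (Finset.Icc 1 k).sigma fun q => (Finset.Ico 1 (1 + q)).filter fun j => q.Coprime j
  have hS : ∀ p ∈ S, (p.1, p.2) ∈ admissible k := by
    intro p hp
    simp only [S, Finset.mem_sigma, Finset.mem_Icc, Finset.mem_filter, Finset.mem_Ico] at hp
    exact ⟨hp.1.1, hp.1.2, hp.2.1.1, by have := hp.2.1.2; simp only; omega, hp.2.2.symm⟩
  let I : (Σ _ : ℕ, ℕ) → Finset ℤ := fun p =>
    Finset.Ico (eta k p.1 p.2 - ((k / p.1 : ℕ) : ℤ)) (eta k p.1 p.2 + ((k / p.1 : ℕ) : ℤ))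
  have hdisj : (S : Set (Σ _ : ℕ, ℕ)).PairwiseDisjoint I := by
    intro p hp p' hp' hne
    rw [Function.onFun, Finset.disjoint_left]
    intro n h1 h2
    rw [Finset.mem_Ico] at h1 h2
    have := eq_of_mem_peak_intervals hζ hξ (hS p hp) (hS p' hp') h1.1 h1.2 h2.1 h2.2
    rw [Prod.mk.injEq] at this
    exact hne (Sigma.ext this.1 (heq_of_eq this.2))
  have hcard : (S.biUnion I).card = k * (k + 1) := by
    rw [Finset.card_biUnion hdisj, ← two_mul_sum_totient_mul_div, Finset.sum_sigma, Finset.mul_sum]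
    refine Finset.sum_congr rfl fun q _ => ?_
    have : ∀ j ∈ (Finset.Ico 1 (1 + q)).filter fun j => q.Coprime j,
        (I ⟨q, j⟩).card = 2 * (k / q) := by
      intro j _
      simp only [I, Int.card_Ico]
      omega
    rw [Finset.sum_congr rfl this, Finset.sum_const, Nat.filter_coprime_Ico_eq_totient, smul_eq_mul]
    ring
  have hsub : S.biUnion I ⊆ Finset.Ico (0 : ℤ) ((k : ℤ) ^ 2 + k) := by
    intro n hn
    rw [Finset.mem_biUnion] at hn
    obtain ⟨p, hp, hn⟩ := hn
    obtain ⟨hq, hqk, hj1, hjq, -⟩ := hS p hp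
    have h1 := div_le_eta hq hqk hj1
    have h2 := eta_le_sub (k := k) hq hjq
    rw [Finset.mem_Ico] at hn ⊢
    simp only at h1 h2
    omega
  -- The disjoint intervals contain `k (k + 1)` integers in total, as many as the ambient interval,
  -- so they fill it.
  have heq := Finset.eq_of_subset_of_card_le hsub (by
    rw [hcard, Int.card_Ico, sub_zero, Int.toNat_le]
    push_cast
    exact (by ring : (k : ℤ) ^ 2 + k = k * (k + 1)).le)
  have hmem : n ∈ S.biUnion I := by
    rw [heq, Finset.mem_Ico]
    exact ⟨h0, hn⟩
  rw [Finset.mem_biUnion] at hmem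
  obtain ⟨p, hp, h⟩ := hmem
  rw [Finset.mem_Ico] at h
  exact ⟨_, hS p hp, h⟩

end tiling

/-! ### Local maxima of the line graph -/

section peaks

theorem lineGraph_eq (g : ℤ → ℝ) {n : ℤ} {x : ℝ} (h1 : (n : ℝ) ≤ x) (h2 : x ≤ n + 1) :
    lineGraph g x = g n + (x - n) * (g (n + 1) - g n) := by
  rcases h2.lt_or_eq with h | rfl
  · have : ⌊x⌋ = n := Int.floor_eq_iff.2 ⟨h1, h⟩
    rw [lineGraph, Int.fract, this]
  · have : ⌊(n : ℝ) + 1⌋ = n + 1 := by simp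
    rw [lineGraph, Int.fract, this]
    push_cast
    ring

theorem lineGraph_intCast (g : ℤ → ℝ) (n : ℤ) : lineGraph g n = g n := by
  rw [lineGraph_eq g le_rfl (by simp)]
  ring

theorem IsLocalMaxOn.exists_ball {f : ℝ → ℝ} {s : Set ℝ} {x : ℝ} (h : IsLocalMaxOn f s x) :
    ∃ ε > 0, ∀ y ∈ s, |y - x| < ε → f y ≤ f x := by
  obtain ⟨ε, hε, hs⟩ := Metric.mem_nhdsWithin_iff.1 h
  exact ⟨ε, hε, fun y hy hyx => hs ⟨by rwa [Metric.mem_ball, Real.dist_eq], hy⟩⟩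

theorem not_isLocalMaxOn_of_lt_succ {g : ℤ → ℝ} {b x : ℝ} {n : ℤ} (h0 : 0 ≤ n)
    (hb : (n : ℝ) + 1 ≤ b) (h1 : (n : ℝ) ≤ x) (h2 : x < n + 1) (hg : g n < g (n + 1)) :
    ¬ IsLocalMaxOn (lineGraph g) (Set.Icc 0 b) x := by
  intro h
  obtain ⟨ε, hε, hmax⟩ := h.exists_ball
  have h0' : (0 : ℝ) ≤ n := by exact_mod_cast h0
  set y := min (x + ε / 2) (n + 1) with hy
  have hy1 : x < y := lt_min (by linarith) h2
  have hy2 : y ≤ n + 1 := min_le_right _ _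
  have hy3 : y ≤ x + ε / 2 := min_le_left _ _
  have := hmax y ⟨by linarith, by linarith⟩ (by rw [abs_of_pos] <;> linarith)
  rw [lineGraph_eq g h1 h2.le, lineGraph_eq g (by linarith) hy2] at this
  nlinarith

theorem not_isLocalMaxOn_of_succ_lt {g : ℤ → ℝ} {b x : ℝ} {n : ℤ} (h0 : 0 ≤ n)
    (hb : (n : ℝ) + 1 ≤ b) (h1 : (n : ℝ) < x) (h2 : x ≤ n + 1) (hg : g (n + 1) < g n) :
    ¬ IsLocalMaxOn (lineGraph g) (Set.Icc 0 b) x := by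
  intro h
  obtain ⟨ε, hε, hmax⟩ := h.exists_ball
  have h0' : (0 : ℝ) ≤ n := by exact_mod_cast h0
  set y := max (x - ε / 2) n with hy
  have hy1 : y < x := max_lt (by linarith) h1
  have hy2 : (n : ℝ) ≤ y := le_max_right _ _
  have hy3 : x - ε / 2 ≤ y := le_max_left _ _
  have := hmax y ⟨by linarith, by linarith⟩ (by rw [abs_of_neg] <;> linarith)
  rw [lineGraph_eq g h1.le h2, lineGraph_eq g hy2 (by linarith)] at this
  nlinarith

theorem isLocalMaxOn_lineGraph {g : ℤ → ℝ} (s : Set ℝ) {n : ℤ} (h1 : g (n + 1) ≤ g n)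
    (h2 : g (n - 1) ≤ g n) : IsLocalMaxOn (lineGraph g) s n := by
  refine Metric.mem_nhdsWithin_iff.2 ⟨1, one_pos, ?_⟩
  rintro y ⟨hy, -⟩
  rw [Metric.mem_ball, Real.dist_eq, abs_lt] at hy
  change lineGraph g y ≤ lineGraph g n
  rw [lineGraph_intCast]
  rcases le_total (n : ℝ) y with h | h
  · rw [lineGraph_eq g h (by linarith)]
    nlinarith
  · rw [lineGraph_eq g (n := n - 1) (by push_cast; linarith) (by push_cast; linarith),
      sub_add_cancel]
    push_cast
    nlinarith

variable {k : ℕ} {ζ ξ : ℂ}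

theorem localPeaks_bandNullity (hk : 1 ≤ k) (hζ : IsPrimitiveRoot ζ k)
    (hξ : IsPrimitiveRoot ξ (k + 1)) :
    localPeaks (fun n => (bandNullity k ζ ξ n : ℝ)) ((k : ℝ) ^ 2 + k) =
      (fun p : ℕ × ℕ => ((eta k p.1 p.2 : ℝ), ((k / p.1 : ℕ) : ℝ))) '' admissible k := by
  have hval : ∀ p ∈ admissible k, ∀ n : ℤ, |n - eta k p.1 p.2| ≤ ((k / p.1 : ℕ) : ℤ) →
      (bandNullity k ζ ξ n : ℝ) = ((k / p.1 : ℕ) : ℝ) - |(n : ℝ) - eta k p.1 p.2| := by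
    rintro p ⟨hq, hqk, -, -, hj⟩ n hn
    have := congrArg (Int.cast : ℤ → ℝ) (bandNullity_eq_sub_abs hζ hξ hq hqk hj hn)
    rwa [Int.cast_sub, Int.cast_abs, Int.cast_sub, Int.cast_natCast, Int.cast_natCast] at this
  apply Set.Subset.antisymm
  · rintro ⟨x, y⟩ ⟨⟨hx0, hxb⟩, hy, hmax⟩
    simp only at hx0 hxb hy hmax
    -- A unit segment `[n, n + 1]` containing `x`, with `x` at its right end only when `x` is the
    -- end of the whole interval.
    obtain ⟨n, hn0, hnb, hn1, hn2⟩ : ∃ n : ℤ, 0 ≤ n ∧ n < (k : ℤ) ^ 2 + k ∧ (n : ℝ) ≤ x ∧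
        x ≤ n + 1 ∧ (x = n + 1 → x = (k : ℝ) ^ 2 + k) := by
      rcases hxb.lt_or_eq with h | h
      · refine ⟨⌊x⌋, Int.floor_nonneg.2 hx0, ?_, Int.floor_le x, (Int.lt_floor_add_one x).le,
          fun h' => absurd h' (Int.lt_floor_add_one x).ne⟩
        rw [Int.floor_lt]
        push_cast
        exact h
      · have hk' : (1 : ℤ) ≤ k := by exact_mod_cast hk
        refine ⟨(k : ℤ) ^ 2 + k - 1, by nlinarith, by omega, ?_, ?_, fun _ => h⟩
        · push_cast; linarith
        · push_cast; linarith
    obtain ⟨p, hp, h1, h2⟩ := exists_peak_interval hζ hξ hn0 hnb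
    have hb : (n : ℝ) + 1 ≤ (k : ℝ) ^ 2 + k := by exact_mod_cast hnb
    have hfb : eta k p.1 p.2 ≤ (k : ℤ) ^ 2 + k - (k / p.1 : ℕ) := eta_le_sub hp.1 hp.2.2.2.1
    have e0 := hval p hp n (by rw [abs_le]; omega)
    have e1 := hval p hp (n + 1) (by rw [abs_le]; omega)
    refine ⟨p, hp, ?_⟩
    rcases lt_trichotomy n (eta k p.1 p.2) with hlt | heq | hgt
    · have hlt' : (n : ℝ) + 1 ≤ eta k p.1 p.2 := by exact_mod_cast hlt
      rw [abs_of_nonpos (by linarith)] at e0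
      push_cast at e1
      rw [abs_of_nonpos (by linarith)] at e1
      rcases hn2.1.lt_or_eq with h | h
      · exact absurd hmax (not_isLocalMaxOn_of_lt_succ hn0 hb hn1 h (by linarith))
      -- Here `x` would be the right end `k² + k`, but the segment ends at or before `η ≤ k² + k - k
      -- / q`.
      · exfalso
        have h3 := h.symm.trans (hn2.2 h)
        have h4 : n + 1 = (k : ℤ) ^ 2 + k := by exact_mod_cast h3
        have hf : 1 ≤ k / p.1 := Nat.div_pos hp.2.1 hp.1
        omega
    · rw [heq] at hn1 hn2 e0 e1 hb hn0
      push_cast at e1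
      rw [sub_self, abs_zero] at e0
      rw [add_sub_cancel_left, abs_one] at e1
      rcases hn1.lt_or_eq with h | h
      · exact absurd hmax (not_isLocalMaxOn_of_succ_lt hn0 hb h hn2.1 (by linarith))
      · rw [hy, ← h, lineGraph_intCast, e0, sub_zero]
    · have hgt' : (eta k p.1 p.2 : ℝ) + 1 ≤ n := by exact_mod_cast hgt
      have e2 := hval p hp (n - 1) (by rw [abs_le]; omega)
      rw [abs_of_nonneg (by linarith)] at e0
      push_cast at e1 e2
      rw [abs_of_nonneg (by linarith)] at e1 e2
      rcases hn1.lt_or_eq with h | h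
      · exact absurd hmax (not_isLocalMaxOn_of_succ_lt hn0 hb h hn2.1 (by linarith))
      -- At an integer `x = n` beyond the peak, the segment to its left already descends.
      · have hf0 := div_le_eta hp.1 hp.2.1 hp.2.2.1
        refine absurd hmax (not_isLocalMaxOn_of_succ_lt (n := n - 1) (by omega) ?_ ?_ ?_ ?_)
        · push_cast; linarith
        · push_cast; linarith
        · push_cast; linarith
        · rw [sub_add_cancel]; linarith
  · rintro _ ⟨p, hp, rfl⟩
    have h1 := div_le_eta hp.1 hp.2.1 hp.2.2.1
    have h2 : eta k p.1 p.2 ≤ (k : ℤ) ^ 2 + k - (k / p.1 : ℕ) := eta_le_sub hp.1 hp.2.2.2.1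
    have hf : 1 ≤ k / p.1 := Nat.div_pos hp.2.1 hp.1
    have e0 := hval p hp _ (by rw [sub_self, abs_zero]; positivity)
    have e1 := hval p hp (eta k p.1 p.2 + 1) (by
      rw [add_sub_cancel_left, abs_one]; exact_mod_cast hf)
    have e2 := hval p hp (eta k p.1 p.2 - 1) (by
      rw [sub_sub_cancel_left, abs_neg, abs_one]; exact_mod_cast hf)
    rw [sub_self, abs_zero, sub_zero] at e0
    push_cast at e1 e2
    rw [add_sub_cancel_left, abs_one] at e1
    rw [sub_sub_cancel_left, abs_neg, abs_one] at e2
    refine ⟨⟨?_, ?_⟩, ?_, ?_⟩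
    · have : 0 ≤ eta k p.1 p.2 := le_trans (by positivity) h1
      change (0 : ℝ) ≤ (eta k p.1 p.2 : ℝ)
      exact_mod_cast this
    · have : eta k p.1 p.2 ≤ (k : ℤ) ^ 2 + k := by omega
      change (eta k p.1 p.2 : ℝ) ≤ (k : ℝ) ^ 2 + k
      exact_mod_cast this
    · simp only
      rw [lineGraph_intCast, e0]
    · exact isLocalMaxOn_lineGraph _ (by linarith) (by linarith)

end peaks

theorem theorem7p5 (k : ℕ) (hk : 1 ≤ k) (ζ ξ : ℂ)
    (hζ : IsPrimitiveRoot ζ k) (hξ : IsPrimitiveRoot ξ (k + 1)) :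
    -- for `n > k`, `N(n,k)` is the nullity of the band matrix `A(n,k)`
    (∀ n : ℕ, k < n → nullity (bandMatrix n k) = bandNullity k ζ ξ (n : ℤ)) ∧
    -- the cycles of `G(η(q,j),k)` are exactly the `f` distinct explicit cycles of length `q`
    (∀ q j : ℕ, (q, j) ∈ admissible k →
      (fun C : Cycle (Fin (k + 1)) => C.map fun v : Fin (k + 1) => ((v : ℕ) : ℤ)) ''
          (bandGraph (eta k q j) k).cycles
        = cCycle k q j '' Set.Icc 1 (k / q) ∧
      Set.InjOn (cCycle k q j) (Set.Icc 1 (k / q)) ∧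
      (bandGraph (eta k q j) k).cycles.ncard = k / q ∧
      ∀ C ∈ (bandGraph (eta k q j) k).cycles, C.length = q) ∧
    -- the numbers `η(q,j)` are all distinct
    Set.InjOn (fun p : ℕ × ℕ => eta k p.1 p.2) (admissible k) ∧
    -- the points `(η(q,j), f)` are all the local peaks of the line graph on `[0, k² + k]`
    localPeaks (fun n => (bandNullity k ζ ξ n : ℝ)) ((k : ℝ) ^ 2 + k)
      = (fun p : ℕ × ℕ => ((eta k p.1 p.2 : ℝ), ((k / p.1 : ℕ) : ℝ))) '' admissible k ∧
    -- every `N(n,k)` with `0 ≤ n < k² + k` is determined by the peaks: around each peak the line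
    -- graph is an isosceles right triangle, and these triangles tile the horizontal range
    (∀ q j : ℕ, (q, j) ∈ admissible k → ∀ n : ℤ, |n - eta k q j| ≤ ((k / q : ℕ) : ℤ) →
      (bandNullity k ζ ξ n : ℤ) = ((k / q : ℕ) : ℤ) - |n - eta k q j|) ∧
    (∀ q j : ℕ, (q, j) ∈ admissible k → ((k / q : ℕ) : ℤ) ≤ eta k q j ∧
      eta k q j ≤ (k : ℤ) ^ 2 + k - ((k / q : ℕ) : ℤ)) ∧
    (∀ n : ℤ, 0 ≤ n → n < (k : ℤ) ^ 2 + k →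
      ∃! p : ℕ × ℕ, p ∈ admissible k ∧ eta k p.1 p.2 - ((k / p.1 : ℕ) : ℤ) ≤ n ∧
        n < eta k p.1 p.2 + ((k / p.1 : ℕ) : ℤ)) := by
  refine ⟨fun n hn => nullity_bandMatrix hk hζ hξ (by omega), ?_, injOn_eta,
    localPeaks_bandNullity hk hζ hξ, ?_, ?_, ?_⟩
  · rintro q j ⟨hq, hqk, -, -, hj⟩
    exact ⟨image_map_cycles_bandGraph_eta hq hqk hj, injOn_cCycle hq hj,
      ncard_cycles_bandGraph_eta hq hqk hj,
      fun C hC => length_of_mem_cycles_bandGraph_eta hq hqk hj hC⟩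
  · rintro q j ⟨hq, hqk, -, -, hj⟩ n hn
    exact bandNullity_eq_sub_abs hζ hξ hq hqk hj hn
  · rintro q j ⟨hq, hqk, hj, hjq, -⟩
    exact ⟨div_le_eta hq hqk hj, eta_le_sub hq hjq⟩
  · intro n h0 hn
    obtain ⟨p, hp, h⟩ := exists_peak_interval hζ hξ h0 hn
    exact ⟨p, ⟨hp, h⟩, fun p' h' =>
      eq_of_mem_peak_intervals hζ hξ h'.1 hp h'.2.1 h'.2.2 h.1 h.2⟩
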